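/- Let $N\in\mathbb Z$. Complexes are cochain complexes of $\mathbb C$-vector spaces. **dg Lie algebras.** A dg Lie algebra with bracket of degree $q$ is a complex $(\mathfrak g^{[*]},d)$ with a bilinear bracket such that, for homogeneous $a,b,c$: $|[a,b]|=|a|+|b|+q$; $d[a,b]=[da,b]+(-1)^{|a|+q}[a,db]$; $[a,b]=-(-1)^{(|a|+q)(|b|+q)}[b,a]$; $[a,[b,c]]=[[a,b],c]+(-1)^{(|a|+q)(|b|+q)}[b,[a,c]]$. **dg vertex Lie algebras.** A dg vertex Lie algebra (with $|x|=-2N$) is a complex $(U^{[*]},d)$ with a linear map $u\mapsto Y^-(u,x)=\sum_{n\ge 0}u_{(n)}x^{-n-1}$, $u_{(n)}\in\mathrm{End}(U)$, such that for homogeneous $u,v$ one has $|u_{(n)}v|=|u|+|v|-2N(n+1)$ and $d(u_{(n)}v)=(du)_{(n)}v+(-1)^{|u|}u_{(n)}dv$, and with a linear map $\mathcal D:U\to U$ of degree $2N$ commuting with $d$, such that for homogeneous $u,v$: (i) $u_{(n)}v=0$ for $n\gg0$; (ii) $[\mathcal D,Y^-(u,x)]=Y^-(\mathcal Du,x)=\frac{d}{dx}Y^-(u,x)$;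 (iii) $Y^-(u,x)v\simeq(-1)^{|u||v|}e^{x\mathcal D}Y^-(v,-x)u$; (iv) $x_2^{-1}\delta(\frac{x_1-x_0}{x_2})Y^-(Y^-(u,x_0)v,x_2)\simeq x_0^{-1}\delta(\frac{x_1-x_2}{x_0})Y^-(u,x_1)Y^-(v,x_2)-(-1)^{|u||v|}x_0^{-1}\delta(\frac{x_2-x_1}{-x_0})Y^-(v,x_2)Y^-(u,x_1)$. Here $\delta(\frac{x-y}{z})=\sum_{n\in\mathbb Z}\sum_{m\ge0}(-1)^m\binom nm x^{n-m}y^mz^{-n}$, and $\simeq$ means equality of the coefficients of all monomials in which every variable has a strictly negative exponent. **The dg Lie algebra of a dg vertex Lie algebra.** Give $\mathbb C[t,t^{-1}]$ the grading $|t|=-2N$ and zero differential. For a dg vertex Lie algebra $U^{[*]}$ let $\mathcal L(U^{[*]})$ be the quotient complex of $U^{[*]}\otimes\mathbb C[t,t^{-1}]$ by the image of $u\otimes t^n\mapsto\mathcal Du\otimes t^n+n\,u\otimes t^{n-1}$. Write $u_n$ for the class of $u\otimes t^n$, so that $d(u_n)=(du)_n$, and equip $\mathcal L(U^{[*]})$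 with the (well-defined) bracket $[u_n,v_p]=\sum_{i\ge0}\binom ni(u_{(i)}v)_{n+p-i}$. **The data.** Let $(\mathfrak g^{[*]},d)$ be a dg Lie algebra with bracket of degree $-2N$, and let $\langle\cdot,\cdot\rangle:\mathfrak g\times\mathfrak g\to\mathbb C$ be a bilinear form such that, for homogeneous $a,b,c$: $\langle a,b\rangle=0$ unless $|a|+|b|=4N$; $\langle da,b\rangle+(-1)^{|a|}\langle a,db\rangle=0$; $\langle a,b\rangle=(-1)^{|a|}\langle b,a\rangle$; $\langle[a,b],c\rangle=\langle a,[b,c]\rangle$. Let $\widehat{\mathfrak g}^{[*]}=\mathfrak g^{[*]}\otimes\mathbb C[t,t^{-1}]\oplus\mathbb CK$ with $|t|=-2N$, $|K|=2N$, $d(a\otimes t^n)=da\otimes t^n$, $dK=0$, with $K$ central and $$[a\otimes t^m,b\otimes t^n]=[a,b]\otimes t^{m+n}+m\langle a,b\rangle\delta_{m+n,0}K .$$ Let $U^{[*]}=\mathbb C[\mathcal D]\otimes\mathfrak g^{[*]}\oplus\mathbb C\mathbf K$ with $|\mathcal D|=2N$, $|\mathbf K|=0$, $d(\mathcal D^ka)=\mathcal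 D^k(da)$, $d\mathbf K=0$, $\mathcal D\mathbf K=0$. With $\mathcal D^{(k)}=\frac1{k!}\mathcal D^k$, the products $u_{(n)}v$ ($n\ge0$) are the bilinear ones determined, for $a,b\in\mathfrak g$ and $k\ge0$, by - $a_{(0)}b=[a,b]$, $a_{(1)}b=\langle a,b\rangle\mathbf K$, $a_{(n)}b=0$ for $n\ge2$; - $a_{(n)}\mathbf K=0$ and $\mathbf K_{(n)}=0$; - $a_{(n)}(\mathcal D^{(k)}b)=\sum_{i=0}^k\binom ni\mathcal D^{(k-i)}(a_{(n-i)}b)$; - $((-\mathcal D)^{(k)}a)_{(n)}=\binom nk a_{(n-k)}$. **Proposition.** $U^{[*]}$ is a dg vertex Lie algebra; $\mathcal L(U^{[*]})$ and $\widehat{\mathfrak g}^{[*]}$ are dg Lie algebras with brackets of degree $-2N$; and there is an isomorphism of dg Lie algebras $\mathcal L(U^{[*]})\to\widehat{\mathfrak g}^{[*]}$ (linear bijection preserving degrees, differentials and brackets) with $a_n\mapsto a\otimes t^n$ for all $a\in\mathfrak g$, $n\in\mathbb Z$, and $\mathbf K_{-1}\mapsto K$. -/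

import Mathlib

noncomputable section

namespace DGVertex

/-! ### Cochain complexes and dg Lie algebras

A cochain complex over `ℂ` is given by its total space `V = ⨁ₚ V^[p]`, the family of
homogeneous pieces `𝒱 p = V^[p]` and the differential `d`. -/

section Complexes

variable {V : Type*} [AddCommGroup V] [Module ℂ V]

/-- `(V, d)` with homogeneous pieces `𝒱 p` is a cochain complex over `ℂ`. -/
structure IsCochainComplex (𝒱 : ℤ → Submodule ℂ V) (d : V →ₗ[ℂ] V) : Prop where
  isInternal : DirectSum.IsInternal 𝒱
  d_mem : ∀ (p : ℤ) (v : V), v ∈ 𝒱 p → d v ∈ 𝒱 (p + 1)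
  d_d : ∀ v : V, d (d v) = 0

/-- A dg Lie algebra whose bracket has degree `q`. -/
structure IsDGLieAlgebra (q : ℤ) (𝒱 : ℤ → Submodule ℂ V) (d : V →ₗ[ℂ] V)
    (br : V →ₗ[ℂ] V →ₗ[ℂ] V) : Prop extends IsCochainComplex 𝒱 d where
  br_mem : ∀ (m n : ℤ) (a b : V), a ∈ 𝒱 m → b ∈ 𝒱 n → br a b ∈ 𝒱 (m + n + q)
  d_br : ∀ (m : ℤ) (a b : V), a ∈ 𝒱 m →
    d (br a b) = br (d a) b + (-1 : ℂ) ^ (m + q) • br a (d b)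
  antisymm : ∀ (m n : ℤ) (a b : V), a ∈ 𝒱 m → b ∈ 𝒱 n →
    br a b = -((-1 : ℂ) ^ ((m + q) * (n + q)) • br b a)
  jacobi : ∀ (m n : ℤ) (a b c : V), a ∈ 𝒱 m → b ∈ 𝒱 n →
    br a (br b c) = br (br a b) c + (-1 : ℂ) ^ ((m + q) * (n + q)) • br b (br a c)

/-- An invariant form `⟨·,·⟩ : V ⊗ V → ℂ[2q]` on a dg Lie algebra with bracket of degree `q`. -/
structure IsInvariantForm (q : ℤ) (𝒱 : ℤ → Submodule ℂ V) (d : V →ₗ[ℂ] V)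
    (br : V →ₗ[ℂ] V →ₗ[ℂ] V) (form : V →ₗ[ℂ] V →ₗ[ℂ] ℂ) : Prop where
  degree : ∀ (m n : ℤ) (a b : V), a ∈ 𝒱 m → b ∈ 𝒱 n → m + n + 2 * q ≠ 0 → form a b = 0
  d_form : ∀ (m : ℤ) (a b : V), a ∈ 𝒱 m →
    form (d a) b + (-1 : ℂ) ^ (m + 2 * q) * form a (d b) = 0
  symm : ∀ (m n : ℤ) (a b : V), a ∈ 𝒱 m → b ∈ 𝒱 n →
    form a b = (-1 : ℂ) ^ (m + 2 * q) * form b a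
  invariant : ∀ a b c : V, form (br a b) c = form a (br b c)

/-- The linear bijection `φ` is an isomorphism of dg Lie algebras. -/
structure IsDGLieIso {W : Type*} [AddCommGroup W] [Module ℂ W]
    (𝒱 : ℤ → Submodule ℂ V) (dV : V →ₗ[ℂ] V) (brV : V →ₗ[ℂ] V →ₗ[ℂ] V)
    (𝒲 : ℤ → Submodule ℂ W) (dW : W →ₗ[ℂ] W) (brW : W →ₗ[ℂ] W →ₗ[ℂ] W)
    (φ : V ≃ₗ[ℂ] W) : Prop where
  mem_iff : ∀ (p : ℤ) (v : V), φ v ∈ 𝒲 p ↔ v ∈ 𝒱 p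
  map_d : ∀ v : V, φ (dV v) = dW (φ v)
  map_br : ∀ v w : V, φ (brV v w) = brW (φ v) (φ w)

end Complexes

/-! ### dg vertex Lie algebras -/

section VertexLie

variable {U : Type*} [AddCommGroup U] [Module ℂ U]

/-- The coefficient of `x ^ e` in `Y⁻(u, x) v = ∑_{n ≥ 0} u_(n) v x ^ (-n-1)`, where
`mode n u v = u_(n) v`. -/
def Yminus (mode : ℕ → U →ₗ[ℂ] U →ₗ[ℂ] U) (u v : U) (e : ℤ) : U :=
  if e < 0 then mode (-e - 1).toNat u v else 0

/-- The coefficient of `x₀ ^ e₀ x₁ ^ e₁ x₂ ^ e₂` in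
`x₂⁻¹ δ((x₁ - x₀) / x₂) Y⁻(Y⁻(u, x₀) v, x₂) w`, where
`x₂⁻¹ δ((x₁ - x₀) / x₂) = ∑_{n ∈ ℤ} ∑_{m ≥ 0} (-1)^m (n choose m) x₁^(n-m) x₀^m x₂^(-n-1)`
(only the terms with `n - m = e₁` contribute). -/
def jacobiIterate (mode : ℕ → U →ₗ[ℂ] U →ₗ[ℂ] U) (u v w : U) (e₀ e₁ e₂ : ℤ) : U :=
  ∑ᶠ m : ℕ, ((-1 : ℤ) ^ m * Ring.choose (e₁ + m) m) •
    Yminus mode (Yminus mode u v (e₀ - m)) w (e₂ + (e₁ + m) + 1)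

/-- The coefficient of `x₀ ^ e₀ x₁ ^ e₁ x₂ ^ e₂` in
`x₀⁻¹ δ((x₁ - x₂) / x₀) Y⁻(u, x₁) Y⁻(v, x₂) w`, where
`x₀⁻¹ δ((x₁ - x₂) / x₀) = ∑_{n ∈ ℤ} ∑_{m ≥ 0} (-1)^m (n choose m) x₁^(n-m) x₂^m x₀^(-n-1)`
(only the terms with `n = -e₀ - 1` contribute). -/
def jacobiProduct (mode : ℕ → U →ₗ[ℂ] U →ₗ[ℂ] U) (u v w : U) (e₀ e₁ e₂ : ℤ) : U :=
  ∑ᶠ m : ℕ, ((-1 : ℤ) ^ m * Ring.choose (-e₀ - 1) m) •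
    Yminus mode u (Yminus mode v w (e₂ - m)) (e₁ - (-e₀ - 1) + m)

/-- The coefficient of `x₀ ^ e₀ x₁ ^ e₁ x₂ ^ e₂` in
`x₀⁻¹ δ((x₂ - x₁) / (-x₀)) Y⁻(v, x₂) Y⁻(u, x₁) w`, where `x₀⁻¹ δ((x₂ - x₁) / (-x₀)) =
∑_{n ∈ ℤ} (-1)^n ∑_{m ≥ 0} (-1)^m (n choose m) x₂^(n-m) x₁^m x₀^(-n-1)`
(only the terms with `n = -e₀ - 1` contribute). -/
def jacobiOpposite (mode : ℕ → U →ₗ[ℂ] U →ₗ[ℂ] U) (u v w : U) (e₀ e₁ e₂ : ℤ) : U :=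
  ((-1 : ℂ) ^ (-e₀ - 1)) • ∑ᶠ m : ℕ, ((-1 : ℤ) ^ m * Ring.choose (-e₀ - 1) m) •
    Yminus mode v (Yminus mode u w (e₁ - m)) (e₂ - (-e₀ - 1) + m)

/-- A dg vertex Lie algebra with formal variable `x` of degree `-2N`: the complex `(U, d)`,
the modes `mode n u v = u_(n) v` of `Y⁻(u, x) v`, and the operator `D` of degree `2N`.
As `D` has even degree, the super commutator with `D` is the ordinary commutator. The relation
`≃` of equality of singular parts is equality of the coefficients of the monomials in which every
variable has a strictly negative exponent. -/
structure IsDGVertexLieAlgebra (N : ℤ) (𝒰 : ℤ → Submodule ℂ U) (d : U →ₗ[ℂ] U)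
    (mode : ℕ → U →ₗ[ℂ] U →ₗ[ℂ] U) (D : U →ₗ[ℂ] U) : Prop extends IsCochainComplex 𝒰 d where
  /-- `Y⁻` is homogeneous of degree `0`. -/
  mode_mem : ∀ (n : ℕ) (p q : ℤ) (u v : U), u ∈ 𝒰 p → v ∈ 𝒰 q →
    mode n u v ∈ 𝒰 (p + q - 2 * N * (n + 1))
  /-- `Y⁻` commutes with the differentials. -/
  d_mode : ∀ (n : ℕ) (p : ℤ) (u v : U), u ∈ 𝒰 p →
    d (mode n u v) = mode n (d u) v + (-1 : ℂ) ^ (p - 2 * N * (n + 1)) • mode n u (d v)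
  /-- `D : U → U[2N]` is a chain map. -/
  D_mem : ∀ (p : ℤ) (u : U), u ∈ 𝒰 p → D u ∈ 𝒰 (p + 2 * N)
  D_d : ∀ u : U, D (d u) = d (D u)
  truncation : ∀ u v : U, ∃ n₀ : ℕ, ∀ n : ℕ, n₀ ≤ n → mode n u v = 0
  /-- `[D, Y⁻(u, x)] = Y⁻(D u, x)`. -/
  D_comm : ∀ (u v : U) (e : ℤ),
    D (Yminus mode u v e) - Yminus mode u (D v) e = Yminus mode (D u) v e
  /-- `Y⁻(D u, x) = d/dx Y⁻(u, x)`. -/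
  D_deriv : ∀ (u v : U) (e : ℤ),
    Yminus mode (D u) v e = (e + 1) • Yminus mode u v (e + 1)
  /-- `Y⁻(u, x) v ≃ (-1)^(|u||v|) e^(xD) Y⁻(v, -x) u`. -/
  half_skew : ∀ (p q : ℤ) (u v : U), u ∈ 𝒰 p → v ∈ 𝒰 q → ∀ e : ℤ, e < 0 →
    Yminus mode u v e = (-1 : ℂ) ^ (p * q) • ∑ᶠ k : ℕ, ((k.factorial : ℂ)⁻¹) •
      (D ^ k) ((-1 : ℂ) ^ (e - k) • Yminus mode v u (e - k))
  half_jacobi : ∀ (p q : ℤ) (u v w : U), u ∈ 𝒰 p → v ∈ 𝒰 q →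
    ∀ e₀ e₁ e₂ : ℤ, e₀ < 0 → e₁ < 0 → e₂ < 0 →
    jacobiIterate mode u v w e₀ e₁ e₂ = jacobiProduct mode u v w e₀ e₁ e₂ -
      (-1 : ℂ) ^ (p * q) • jacobiOpposite mode u v w e₀ e₁ e₂

end VertexLie

/-! ### Bilinear maps on finitely supported families

For a vector space `M`, the space `ℤ →₀ M` is `M ⊗ ℂ[t, t⁻¹]`, with `Finsupp.single n a` standing
for `a ⊗ t ^ n`; likewise `ℕ →₀ M` is `ℂ[D] ⊗ M`, with `Finsupp.single k a` standing for
`D ^ k ⊗ a`. -/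

section Bilinear

variable {ι κ M M' P : Type*} [AddCommGroup M] [Module ℂ M] [AddCommGroup M'] [Module ℂ M']
  [AddCommGroup P] [Module ℂ P]

/-- The bilinear map with value `B i j a b` on `(single i a, single j b)`. -/
def finsuppBilin (B : ι → κ → M →ₗ[ℂ] M' →ₗ[ℂ] P) :
    (ι →₀ M) →ₗ[ℂ] (κ →₀ M') →ₗ[ℂ] P :=
  Finsupp.lsum ℂ fun i => (Finsupp.lsum ℂ fun j => (B i j).flip).flip

@[simp]
theorem finsuppBilin_single (B : ι → κ → M →ₗ[ℂ] M' →ₗ[ℂ] P) (i : ι) (j : κ) (a : M) (b : M') :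
    finsuppBilin B (Finsupp.single i a) (Finsupp.single j b) = B i j a b := by
  simp [finsuppBilin]

end Bilinear

/-! ### The loop complex `M ⊗ ℂ[t, t⁻¹]`, with `|t| = -2N` -/

section Loop

variable {M : Type*} [AddCommGroup M] [Module ℂ M]

/-- The degree `p` part of `M ⊗ ℂ[t, t⁻¹]`: since `|a ⊗ t ^ n| = |a| - 2Nn`, the coefficient of
`t ^ n` has to lie in `M^[p + 2Nn]`. -/
def loopDeg (N : ℤ) (𝒱 : ℤ → Submodule ℂ M) (p : ℤ) : Submodule ℂ (ℤ →₀ M) where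
  carrier := {f | ∀ n : ℤ, f n ∈ 𝒱 (p + 2 * N * n)}
  add_mem' hf hg n := (𝒱 _).add_mem (hf n) (hg n)
  zero_mem' _ := (𝒱 _).zero_mem
  smul_mem' c _ hf n := (𝒱 _).smul_mem c (hf n)

/-- `d (a ⊗ t ^ n) = d a ⊗ t ^ n`. -/
def loopD (d : M →ₗ[ℂ] M) : (ℤ →₀ M) →ₗ[ℂ] (ℤ →₀ M) :=
  Finsupp.mapRange.linearMap d

end Loop

/-! ### The dg Lie algebra `𝓛(U)` of a dg vertex Lie algebra `U` -/

section ModeLie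

variable {U : Type*} [AddCommGroup U] [Module ℂ U]

/-- `D̂ (u ⊗ t ^ n) = D u ⊗ t ^ n + n u ⊗ t ^ (n - 1)`. -/
def Dhat (D : U →ₗ[ℂ] U) : (ℤ →₀ U) →ₗ[ℂ] (ℤ →₀ U) :=
  Finsupp.lsum ℂ fun n : ℤ =>
    (Finsupp.lsingle n).comp D + (n : ℂ) • Finsupp.lsingle (n - 1)

@[simp]
theorem Dhat_single (D : U →ₗ[ℂ] U) (n : ℤ) (u : U) :
    Dhat D (Finsupp.single n u) =
      Finsupp.single n (D u) + (n : ℂ) • Finsupp.single (n - 1) u := by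
  simp [Dhat]

/-- The space `𝓛(U) = U ⊗ ℂ[t, t⁻¹] / D̂ (U ⊗ ℂ[t, t⁻¹])`. -/
abbrev ModeLie (D : U →ₗ[ℂ] U) : Type _ :=
  (ℤ →₀ U) ⧸ LinearMap.range (Dhat D)

/-- The element `u_n` of `𝓛(U)`, the class of `u ⊗ t ^ n`. -/
def modeOf (D : U →ₗ[ℂ] U) (n : ℤ) : U →ₗ[ℂ] ModeLie D :=
  (LinearMap.range (Dhat D)).mkQ.comp (Finsupp.lsingle n)

/-- The degree `p` part of `𝓛(U)`: the image of the degree `p` part of `U ⊗ ℂ[t, t⁻¹]`. -/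
def modeLieDeg (N : ℤ) (𝒰 : ℤ → Submodule ℂ U) (D : U →ₗ[ℂ] U) (p : ℤ) :
    Submodule ℂ (ModeLie D) :=
  (loopDeg N 𝒰 p).map (LinearMap.range (Dhat D)).mkQ

namespace IsDGVertexLieAlgebra

variable {N : ℤ} {𝒰 : ℤ → Submodule ℂ U} {d : U →ₗ[ℂ] U}
  {mode : ℕ → U →ₗ[ℂ] U →ₗ[ℂ] U} {D : U →ₗ[ℂ] U}

theorem loopD_Dhat (h : IsDGVertexLieAlgebra N 𝒰 d mode D) (f : ℤ →₀ U) :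
    loopD d (Dhat D f) = Dhat D (loopD d f) := by
  induction f using Finsupp.induction_linear with
  | zero => simp
  | add f g hf hg => simp [hf, hg]
  | single n u =>
    rw [Dhat_single, map_add, map_smul]
    simp [loopD, h.D_d]

/-- The differential of `𝓛(U)`: `d (u_n) = (d u)_n`. -/
def modeLieD (h : IsDGVertexLieAlgebra N 𝒰 d mode D) : ModeLie D →ₗ[ℂ] ModeLie D :=
  Submodule.mapQ _ _ (loopD d) <| by
    rintro _ ⟨f, rfl⟩
    exact ⟨loopD d f, (h.loopD_Dhat f).symm⟩

theorem finite_support (h : IsDGVertexLieAlgebra N 𝒰 d mode D) (u v : U) (c : ℕ → ℤ)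
    (e : ℕ → ℤ) :
    (Function.support fun i : ℕ => c i • Finsupp.single (e i) (mode i u v)).Finite := by
  obtain ⟨n₀, hn⟩ := h.truncation u v
  refine (Set.finite_lt_nat n₀).subset fun i hi => ?_
  by_contra hlt
  exact hi (by simp [hn i (not_lt.1 hlt)])

/-- The bilinear map `(u, v) ↦ ∑_{i ≥ 0} (n choose i) u_(i) v ⊗ t ^ (n + p - i)`. -/
def loopTerm (h : IsDGVertexLieAlgebra N 𝒰 d mode D) (n p : ℤ) :
    U →ₗ[ℂ] U →ₗ[ℂ] (ℤ →₀ U) :=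
  LinearMap.mk₂ ℂ
    (fun u v => ∑ᶠ i : ℕ, Ring.choose n i • Finsupp.single (n + p - i) (mode i u v))
    (fun u u' v => by
      rw [← finsum_add_distrib (h.finite_support ..) (h.finite_support ..)]
      simp)
    (fun c u v => by
      rw [smul_finsum' c (h.finite_support ..)]
      simp only [map_smul, LinearMap.smul_apply, ← Finsupp.smul_single]
      exact finsum_congr fun i => smul_comm ..)
    (fun u v v' => by
      rw [← finsum_add_distrib (h.finite_support ..) (h.finite_support ..)]
      simp)
    (fun c u v => by
      rw [smul_finsum' c (h.finite_support ..)]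
      simp only [map_smul, ← Finsupp.smul_single]
      exact finsum_congr fun i => smul_comm ..)

/-- The bilinear map `{u ⊗ t ^ n, v ⊗ t ^ p} = ∑_{i ≥ 0} (n choose i) u_(i) v ⊗ t ^ (n + p - i)`
on `U ⊗ ℂ[t, t⁻¹]`. -/
def loopBracket (h : IsDGVertexLieAlgebra N 𝒰 d mode D) :
    (ℤ →₀ U) →ₗ[ℂ] (ℤ →₀ U) →ₗ[ℂ] (ℤ →₀ U) :=
  finsuppBilin h.loopTerm

theorem exists_loopTerm_eq_sum (h : IsDGVertexLieAlgebra N 𝒰 d mode D) (u v : U) :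
    ∃ n₀ : ℕ, (∀ n, n₀ ≤ n → mode n u v = 0) ∧ ∀ (k : ℕ), n₀ ≤ k → ∀ n p : ℤ,
      h.loopTerm n p u v =
        ∑ i ∈ Finset.range k, Ring.choose n i • Finsupp.single (n + p - i) (mode i u v) := by
  obtain ⟨n₀, hn⟩ := h.truncation u v
  refine ⟨n₀, hn, fun k hk n p => ?_⟩
  refine finsum_eq_sum_of_support_subset _ fun i hi => ?_
  by_contra hlt
  refine hi ?_
  have : n₀ ≤ i := hk.trans (by simpa using hlt)
  simp [hn i this]

theorem mode_D_zero (h : IsDGVertexLieAlgebra N 𝒰 d mode D) (u v : U) : mode 0 (D u) v = 0 := by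
  simpa [Yminus] using h.D_deriv u v (-1)

theorem mode_D_succ (h : IsDGVertexLieAlgebra N 𝒰 d mode D) (n : ℕ) (u v : U) :
    mode (n + 1) (D u) v = -((n : ℤ) + 1) • mode n u v := by
  have key := h.D_deriv u v (-(n : ℤ) - 2)
  have h1 : (-(-(n : ℤ) - 2) - 1).toNat = n + 1 := by omega
  have h2 : (-(-(n : ℤ) - 2 + 1) - 1).toNat = n := by omega
  rw [Yminus, Yminus, if_pos (by omega), if_pos (by omega), h1, h2] at key
  rw [key]
  congr 1
  omega

theorem D_mode (h : IsDGVertexLieAlgebra N 𝒰 d mode D) (n : ℕ) (u v : U) :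
    D (mode n u v) - mode n u (D v) = mode n (D u) v := by
  have key := h.D_comm u v (-(n : ℤ) - 1)
  have h1 : (-(-(n : ℤ) - 1) - 1).toNat = n := by omega
  simpa only [Yminus, if_pos (show (-(n : ℤ) - 1) < 0 by omega), h1] using key

theorem succ_mul_choose (n : ℤ) (i : ℕ) :
    ((i : ℤ) + 1) * Ring.choose n (i + 1) = n * Ring.choose (n - 1) i := by
  have := Ring.choose_smul_choose n (n := i + 1) (k := 1) (by omega)
  simpa using this

theorem sub_mul_choose (n : ℤ) (i : ℕ) :
    (n - i) * Ring.choose n i = n * Ring.choose (n - 1) i := by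
  rw [← succ_mul_choose]
  have := Ring.choose_smul_choose n (n := i + 1) (k := i) (by omega)
  simp at this
  linarith

theorem loopBracket_Dhat_left (h : IsDGVertexLieAlgebra N 𝒰 d mode D) (f g : ℤ →₀ U) :
    h.loopBracket (Dhat D f) g = 0 := by
  induction f using Finsupp.induction_linear with
  | zero => simp
  | add f f' hf hf' => simp [hf, hf']
  | single n u =>
    induction g using Finsupp.induction_linear with
    | zero => simp
    | add g g' hg hg' => rw [map_add, hg, hg', add_zero]
    | single p v =>
      obtain ⟨k, hk, hs⟩ := h.exists_loopTerm_eq_sum u v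
      obtain ⟨k', -, hs'⟩ := h.exists_loopTerm_eq_sum (D u) v
      rw [Dhat_single, map_add, map_smul, LinearMap.add_apply, LinearMap.smul_apply]
      simp only [loopBracket, finsuppBilin_single]
      rw [hs' (max k k' + 1) (by omega), hs (max k k') (by omega), Finset.sum_range_succ',
        h.mode_D_zero, Finset.smul_sum]
      simp only [Finsupp.single_zero, smul_zero, add_zero]
      rw [← Finset.sum_add_distrib]
      refine Finset.sum_eq_zero fun i _ => ?_
      rw [h.mode_D_succ, ← Int.cast_smul_eq_zsmul ℂ, ← Int.cast_smul_eq_zsmul ℂ (Ring.choose _ _),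
        ← Int.cast_smul_eq_zsmul ℂ (-((i : ℤ) + 1)), ← Finsupp.smul_single, smul_smul, smul_smul]
      have e1 : n + p - ((i + 1 : ℕ) : ℤ) = n - 1 + p - i := by push_cast; ring
      rw [e1, ← add_smul]
      have e2 := succ_mul_choose n i
      have e3 : ((Ring.choose n (i + 1) : ℤ) : ℂ) * ((-((i : ℤ) + 1) : ℤ) : ℂ) +
          (n : ℂ) * ((Ring.choose (n - 1) i : ℤ) : ℂ) = 0 := by
        have e4 : (((i : ℤ) + 1 : ℤ) : ℂ) * ((Ring.choose n (i + 1) : ℤ) : ℂ) =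
            (n : ℂ) * ((Ring.choose (n - 1) i : ℤ) : ℂ) := by exact_mod_cast e2
        rw [← e4]
        push_cast
        ring
      rw [e3, zero_smul]

theorem loopBracket_Dhat_right (h : IsDGVertexLieAlgebra N 𝒰 d mode D) (f g : ℤ →₀ U) :
    h.loopBracket f (Dhat D g) = Dhat D (h.loopBracket f g) := by
  induction f using Finsupp.induction_linear with
  | zero => simp
  | add f f' hf hf' => simp [hf, hf']
  | single n u =>
    induction g using Finsupp.induction_linear with
    | zero => simp
    | add g g' hg hg' => simp only [map_add, hg, hg']
    | single p v =>
      have hz := h.loopBracket_Dhat_left (Finsupp.single n u) (Finsupp.single p v)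
      rw [Dhat_single, map_add, map_smul, LinearMap.add_apply, LinearMap.smul_apply] at hz
      rw [Dhat_single, map_add, map_smul]
      simp only [loopBracket, finsuppBilin_single] at hz ⊢
      obtain ⟨k₁, -, hs₁⟩ := h.exists_loopTerm_eq_sum u v
      obtain ⟨k₂, -, hs₂⟩ := h.exists_loopTerm_eq_sum (D u) v
      obtain ⟨k₃, -, hs₃⟩ := h.exists_loopTerm_eq_sum u (D v)
      have l₁ : k₁ ≤ max k₁ (max k₂ k₃) := by omega
      have l₂ : k₂ ≤ max k₁ (max k₂ k₃) := by omega
      have l₃ : k₃ ≤ max k₁ (max k₂ k₃) := by omega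
      generalize max k₁ (max k₂ k₃) = k at l₁ l₂ l₃
      rw [hs₂ k l₂, hs₁ k l₁] at hz
      rw [hs₃ k l₃, hs₁ k l₁, hs₁ k l₁, map_sum]
      rw [← sub_eq_zero, ← neg_eq_zero, ← hz]
      simp only [Finset.smul_sum, map_zsmul, Dhat_single]
      rw [← Finset.sum_add_distrib, ← Finset.sum_add_distrib, ← Finset.sum_sub_distrib,
        ← Finset.sum_neg_distrib]
      refine Finset.sum_congr rfl fun i _ => ?_
      rw [← h.D_mode, Finsupp.single_sub]
      have e1 : n + (p - 1) - (i : ℤ) = n + p - i - 1 := by ring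
      have e2 : n - 1 + p - (i : ℤ) = n + p - i - 1 := by ring
      rw [e1, e2]
      simp only [← Int.cast_smul_eq_zsmul ℂ]
      have e3 : (n : ℂ) * ((Ring.choose (n - 1) i : ℤ) : ℂ) =
          ((n : ℂ) - i) * ((Ring.choose n i : ℤ) : ℂ) := by
        have := sub_mul_choose n i
        exact_mod_cast this.symm
      rw [smul_smul (n : ℂ), e3]
      push_cast
      module

/-- The bracket of `𝓛(U)`: `[u_n, v_p] = ∑_{i ≥ 0} (n choose i) (u_(i) v)_{n + p - i}`. -/
def modeLieBracket (h : IsDGVertexLieAlgebra N 𝒰 d mode D) :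
    ModeLie D →ₗ[ℂ] ModeLie D →ₗ[ℂ] ModeLie D :=
  Submodule.liftQ _
    (LinearMap.flip <| Submodule.liftQ _
      (h.loopBracket.compr₂ (LinearMap.range (Dhat D)).mkQ).flip <| by
        rintro _ ⟨g, rfl⟩
        refine LinearMap.ext fun f => ?_
        simp [h.loopBracket_Dhat_right]) <| by
    rintro _ ⟨f, rfl⟩
    refine LinearMap.ext fun y => ?_
    obtain ⟨g, rfl⟩ := Submodule.mkQ_surjective _ y
    simp [h.loopBracket_Dhat_left]

theorem modeLieBracket_modeOf (h : IsDGVertexLieAlgebra N 𝒰 d mode D) (n p : ℤ) (u v : U) :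
    h.modeLieBracket (modeOf D n u) (modeOf D p v) =
      ∑ᶠ i : ℕ, Ring.choose n i • modeOf D (n + p - i) (mode i u v) := by
  have : h.modeLieBracket (modeOf D n u) (modeOf D p v) =
      (LinearMap.range (Dhat D)).mkQ (h.loopTerm n p u v) := by
    simp [modeLieBracket, modeOf, loopBracket]
  rw [this, loopTerm, LinearMap.mk₂_apply]
  refine ((LinearMap.range (Dhat D)).mkQ.toAddMonoidHom.map_finsum
    (h.finite_support ..)).trans (finsum_congr fun i => ?_)
  exact map_zsmul (LinearMap.range (Dhat D)).mkQ _ _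

end IsDGVertexLieAlgebra

end ModeLie

/-! ### The affine dg Lie algebra `ĝ = g ⊗ ℂ[t, t⁻¹] ⊕ ℂK` -/

section Affine

variable {g : Type*} [AddCommGroup g] [Module ℂ g]

/-- The space `g ⊗ ℂ[t, t⁻¹] ⊕ ℂK`. -/
abbrev Affine (g : Type*) [AddCommGroup g] [Module ℂ g] : Type _ := (ℤ →₀ g) × ℂ

/-- The element `a ⊗ t ^ n` of `ĝ`. -/
def affineOf (n : ℤ) (a : g) : Affine g := (Finsupp.single n a, 0)

/-- The element `K` of `ĝ`. -/
def affineK : Affine g := (0, 1)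

/-- The degree `p` part of `ĝ`, where `|t| = -2N` and `|K| = 2N`. -/
def affineDeg (N : ℤ) (𝒢 : ℤ → Submodule ℂ g) (p : ℤ) : Submodule ℂ (Affine g) :=
  (loopDeg N 𝒢 p).prod (if p = 2 * N then ⊤ else ⊥)

/-- `d (a ⊗ t ^ n) = d a ⊗ t ^ n` and `d K = 0`. -/
def affineD (d : g →ₗ[ℂ] g) : Affine g →ₗ[ℂ] Affine g :=
  (loopD d).prodMap 0

/-- `[a ⊗ t ^ m, b ⊗ t ^ n] = [a, b] ⊗ t ^ (m + n) + m ⟨a, b⟩ δ_{m+n,0} K`, with `K` central. -/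
def affineBracket (br : g →ₗ[ℂ] g →ₗ[ℂ] g) (form : g →ₗ[ℂ] g →ₗ[ℂ] ℂ) :
    Affine g →ₗ[ℂ] Affine g →ₗ[ℂ] Affine g :=
  (finsuppBilin fun m n : ℤ =>
      br.compr₂ ((LinearMap.inl ℂ (ℤ →₀ g) ℂ).comp (Finsupp.lsingle (m + n))) +
        (if m + n = 0 then (m : ℂ) else 0) •
          form.compr₂ (LinearMap.inr ℂ (ℤ →₀ g) ℂ)).compl₁₂
    (LinearMap.fst ℂ (ℤ →₀ g) ℂ) (LinearMap.fst ℂ (ℤ →₀ g) ℂ)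

end Affine

/-! ### The complex `U = ℂ[D] ⊗ g ⊕ ℂK` and its modes -/

section Current

variable {g : Type*} [AddCommGroup g] [Module ℂ g]

/-- The space `ℂ[D] ⊗ g ⊕ ℂK`. -/
abbrev Current (g : Type*) [AddCommGroup g] [Module ℂ g] : Type _ := (ℕ →₀ g) × ℂ

/-- The element `D ^ k a` of `U`. -/
def currentOf (k : ℕ) : g →ₗ[ℂ] Current g :=
  (LinearMap.inl ℂ (ℕ →₀ g) ℂ).comp (Finsupp.lsingle k)

/-- The element `K` of `U`. -/
def currentK : Current g := (0, 1)

/-- The degree `p` part of `U`, where `|D| = 2N` and `|K| = 0`: the coefficient of `D ^ k` has to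
lie in `g^[p - 2Nk]`. -/
def currentDeg (N : ℤ) (𝒢 : ℤ → Submodule ℂ g) (p : ℤ) : Submodule ℂ (Current g) :=
  Submodule.prod
    { carrier := {f | ∀ k : ℕ, f k ∈ 𝒢 (p - 2 * N * k)}
      add_mem' := fun hf hg k => (𝒢 _).add_mem (hf k) (hg k)
      zero_mem' := fun _ => (𝒢 _).zero_mem
      smul_mem' := fun c _ hf k => (𝒢 _).smul_mem c (hf k) }
    (if p = 0 then ⊤ else ⊥)

/-- The differential `d (D ^ k a) = D ^ k (d a)`, `d K = 0`. -/
def currentDiff (d : g →ₗ[ℂ] g) : Current g →ₗ[ℂ] Current g :=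
  (Finsupp.mapRange.linearMap d).prodMap 0

/-- The operator `D (D ^ k a) = D ^ (k + 1) a`, `D K = 0`. -/
def currentD : Current g →ₗ[ℂ] Current g :=
  (Finsupp.lmapDomain g ℂ (fun k : ℕ => k + 1)).prodMap 0

/-- The products of generators: `a_(0) b = [a, b]`, `a_(1) b = ⟨a, b⟩ K` and `a_(n) b = 0` for
`n ≥ 2`. -/
def generatorMode (br : g →ₗ[ℂ] g →ₗ[ℂ] g) (form : g →ₗ[ℂ] g →ₗ[ℂ] ℂ) :
    ℕ → g →ₗ[ℂ] g →ₗ[ℂ] Current g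
  | 0 => br.compr₂ (currentOf 0)
  | 1 => form.compr₂ (LinearMap.inr ℂ (ℕ →₀ g) ℂ)
  | _ + 2 => 0

/-- The modes of `U`. With `D^(k) = D ^ k / k!`, they are determined by the products of generators,
by `K_(n) = 0` and `u_(n) K = 0`, and by
`((-D)^(k) a)_(n) = (n choose k) a_(n-k)` and
`a_(n) (D^(l) b) = ∑_{i=0}^{l} (n choose i) D^(l-i) (a_(n-i) b)`;
the resulting value of `(D ^ k a)_(n) (D ^ l b)` is written out here. -/
def currentMode (br : g →ₗ[ℂ] g →ₗ[ℂ] g) (form : g →ₗ[ℂ] g →ₗ[ℂ] ℂ) (n : ℕ) :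
    Current g →ₗ[ℂ] Current g →ₗ[ℂ] Current g :=
  (finsuppBilin fun k l : ℕ =>
      ((-1 : ℂ) ^ k * k.factorial * l.factorial * n.choose k) •
        ∑ i ∈ Finset.range (l + 1), (((n - k).choose i : ℂ) * ((l - i).factorial : ℂ)⁻¹) •
          (generatorMode br form (n - k - i)).compr₂ (currentD ^ (l - i))).compl₁₂
    (LinearMap.fst ℂ (ℕ →₀ g) ℂ) (LinearMap.fst ℂ (ℕ →₀ g) ℂ)

theorem currentMode_generators (br : g →ₗ[ℂ] g →ₗ[ℂ] g) (form : g →ₗ[ℂ] g →ₗ[ℂ] ℂ) (n : ℕ)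
    (a b : g) :
    currentMode br form n (currentOf 0 a) (currentOf 0 b) = generatorMode br form n a b := by
  simp [currentMode, currentOf]

theorem currentMode_K_left (br : g →ₗ[ℂ] g →ₗ[ℂ] g) (form : g →ₗ[ℂ] g →ₗ[ℂ] ℂ) (n : ℕ)
    (v : Current g) : currentMode br form n currentK v = 0 := by
  simp [currentMode, currentK]

theorem currentMode_K_right (br : g →ₗ[ℂ] g →ₗ[ℂ] g) (form : g →ₗ[ℂ] g →ₗ[ℂ] ℂ) (n : ℕ)
    (u : Current g) : currentMode br form n u currentK = 0 := by
  simp [currentMode, currentK]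

theorem currentD_pow_currentOf (k : ℕ) (a : g) :
    (currentD ^ k) (currentOf 0 a) = currentOf k a := by
  induction k with
  | zero => simp
  | succ k ih =>
    rw [pow_succ', Module.End.mul_apply, ih]
    simp [currentD, currentOf]

/-- `((-D)^(k) a)_(n) = (n choose k) a_(n-k)`. -/
theorem currentMode_D_left (br : g →ₗ[ℂ] g →ₗ[ℂ] g) (form : g →ₗ[ℂ] g →ₗ[ℂ] ℂ) (n k : ℕ)
    (a : g) :
    currentMode br form n (((k.factorial : ℂ)⁻¹) • ((-currentD) ^ k) (currentOf 0 a)) =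
      (n.choose k : ℂ) • currentMode br form (n - k) (currentOf 0 a) := by
  have hk : (k.factorial : ℂ) ≠ 0 := by exact_mod_cast k.factorial_ne_zero
  have e : ((-currentD) ^ k) (currentOf 0 a) = (-1 : ℂ) ^ k • currentOf k a := by
    have e' : (-currentD : Current g →ₗ[ℂ] Current g) = (-1 : ℂ) • currentD := (neg_one_smul ℂ _).symm
    rw [e', smul_pow, LinearMap.smul_apply, currentD_pow_currentOf]
  rw [e]
  refine LinearMap.ext fun v => ?_
  obtain ⟨f, c⟩ := v
  induction f using Finsupp.induction_linear with
  | zero => simp [currentMode]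
  | add f f' hf hf' =>
    have : ((f + f', c) : Current g) = (f, c) + (f', c) - (0, c) := by simp
    rw [this, map_sub, map_add, map_sub, map_add, hf, hf']
    simp [currentMode]
  | single l b =>
    simp only [currentMode, currentOf, map_smul, LinearMap.smul_apply, LinearMap.compl₁₂_apply,
      LinearMap.comp_apply, LinearMap.fst_apply, LinearMap.inl_apply, Finsupp.lsingle_apply,
      finsuppBilin_single, smul_smul, Nat.sub_zero]
    congr 1
    have h2 : ((-1 : ℂ) ^ k) * (-1) ^ k = 1 := by rw [← mul_pow]; simp
    simp only [pow_zero, Nat.factorial_zero, Nat.cast_one, Nat.choose_zero_right, one_mul, mul_one]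
    field_simp
    linear_combination ((l.factorial : ℂ) * n.choose k) * h2

/-- `a_(n) (D^(l) b) = ∑_{i=0}^{l} (n choose i) D^(l-i) (a_(n-i) b)`. -/
theorem currentMode_D_right (br : g →ₗ[ℂ] g →ₗ[ℂ] g) (form : g →ₗ[ℂ] g →ₗ[ℂ] ℂ) (n l : ℕ)
    (a b : g) :
    currentMode br form n (currentOf 0 a)
        (((l.factorial : ℂ)⁻¹) • (currentD ^ l) (currentOf 0 b)) =
      ∑ i ∈ Finset.range (l + 1), (n.choose i : ℂ) • (((l - i).factorial : ℂ)⁻¹) •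
        (currentD ^ (l - i)) (currentMode br form (n - i) (currentOf 0 a) (currentOf 0 b)) := by
  have hl : (l.factorial : ℂ) ≠ 0 := by exact_mod_cast l.factorial_ne_zero
  simp only [currentMode_generators, currentD_pow_currentOf]
  simp [currentMode, currentOf, smul_smul, LinearMap.sum_apply, hl]

end Current

end DGVertex

end

open DGVertex

noncomputable section

namespace DGVertex

/-! ### Signs -/

/-! Everything rests on two rules for the modes of `U`: `(D u)_(n) = -n u_(n-1)` and `u_(n) (D v) =
D (u_(n) v) + n u_(n-1) v`. Since `U` is spanned by `K` and iterated `D`-derivatives of elements of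
`g`, any identity stable under these rules need only be checked on `g` and `K`. All modes of `K`
vanish, and `D`, `t` and the modes have even degree, so signs depend only on the degrees of the
arguments modulo 2.

On generators, skew symmetry is antisymmetry of the bracket (mode 0) and symmetry of the form (mode
1). The commutator formula is the Jacobi identity (modes 0, 0) and invariance of the form (modes 0,
1 and 1, 0). The half Jacobi identity at `x₀^(-l-1) x₁^(-m-1) x₂^(-n-1)` is Borcherds' identity with
`l, m, n ≥ 0`. For `l = 0` it is the commutator formula, and all its terms obey, up to sign, the
recursion `S(l+1, m, n) = S(l, m+1, n) - S(l, m, n+1)`, so induction on `l` gives the rest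
(`currentMode_borcherds`).

In `𝓛(U)` the relation `(D u)_n = -n u_(n-1)` rewrites each `(D^k a)_n` as a multiple of `a_(n-k)`,
while `D K = 0` forces `K_n = 0` for `n ≠ -1`. Hence the `a_n` and `K_(-1)` span, and an explicit
map to `ĝ` that respects the relations shows that nothing else collapses. The bracket `[a_n, b_p] =
[a, b]_(n+p) + n ⟨a, b⟩ K_(n+p-1)` is then the affine one, because `K_(n+p-1)` survives only for `n
+ p = 0`. The dg Lie axioms are verified in `ĝ` and carried back to `𝓛(U)` along the isomorphism. -/

theorem neg_one_zpow_congr {x y : ℤ} (h : Even (x - y)) : (-1 : ℂ) ^ x = (-1 : ℂ) ^ y := by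
  rw [show x = x - y + y by ring, zpow_add₀ (by norm_num), h.neg_one_zpow, one_mul]

theorem neg_one_zpow_mul_shift (p q a b : ℤ) :
    (-1 : ℂ) ^ ((p + 2 * a) * (q + 2 * b)) = (-1 : ℂ) ^ (p * q) :=
  neg_one_zpow_congr ⟨p * b + a * q + 2 * a * b, by ring⟩

theorem neg_one_zpow_add_shift (p a : ℤ) : (-1 : ℂ) ^ (p + 2 * a) = (-1 : ℂ) ^ p :=
  neg_one_zpow_congr ⟨a, by ring⟩

/-! ### Internal gradings -/

section Internal

variable {V W : Type*} [AddCommGroup V] [Module ℂ V] [AddCommGroup W] [Module ℂ W]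

/-- The graded pieces of `𝓛(U)` are images in a quotient, where independence is awkward to test; it
is pulled back from `ĝ` instead. -/
theorem isInternal_of_linearEquiv (φ : V ≃ₗ[ℂ] W) {𝒱 : ℤ → Submodule ℂ V}
    {𝒲 : ℤ → Submodule ℂ W} (h : DirectSum.IsInternal 𝒲)
    (hφ : ∀ p v, φ v ∈ 𝒲 p ↔ v ∈ 𝒱 p) : DirectSum.IsInternal 𝒱 := by
  rw [DirectSum.isInternal_submodule_iff_iSupIndep_and_iSup_eq_top] at h ⊢
  have e : 𝒱 = (Submodule.orderIsoMapComap φ.symm) ∘ 𝒲 := by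
    funext p
    ext v
    simp only [Function.comp_apply, Submodule.orderIsoMapComap_apply, Submodule.mem_map]
    constructor
    · intro hv
      exact ⟨φ v, (hφ p v).2 hv, by simp⟩
    · rintro ⟨w, hw, rfl⟩
      rw [← hφ]
      simpa using hw
  rw [e]
  refine ⟨h.1.map_orderIso _, ?_⟩
  simp only [Function.comp_def, ← OrderIso.map_iSup, h.2, OrderIso.map_top]

/-- Independence is tested one coordinate at a time, since for fixed `i` the shift `p ↦ p + s i` is
injective; spanning follows by decomposing the entry of each `single i v`. The shift is `-2Nk` for
`ℂ[D] ⊗ g` and `2Nn` for the loop space. -/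
theorem isInternal_finsupp {ι : Type*} {𝒱 : ℤ → Submodule ℂ V} (h : DirectSum.IsInternal 𝒱)
    (s : ι → ℤ) (𝒲 : ℤ → Submodule ℂ (ι →₀ V))
    (hW : ∀ p f, f ∈ 𝒲 p ↔ ∀ i, f i ∈ 𝒱 (p + s i)) : DirectSum.IsInternal 𝒲 := by
  rw [DirectSum.isInternal_submodule_iff_iSupIndep_and_iSup_eq_top] at h ⊢
  obtain ⟨hi, ht⟩ := h
  constructor
  · intro p
    rw [Submodule.disjoint_def]
    intro f hf hf'
    ext i
    refine Submodule.disjoint_def.1 (hi (p + s i)) _ ((hW p f).1 hf i) ?_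
    have hle : (⨆ (q) (_ : q ≠ p), 𝒲 q) ≤
        (⨆ (q) (_ : q ≠ p + s i), 𝒱 q).comap (Finsupp.lapply i) := by
      refine iSup₂_le fun q hq f hf => ?_
      exact Submodule.mem_iSup_of_mem (q + s i)
        (Submodule.mem_iSup_of_mem (by simpa using hq) ((hW q f).1 hf i))
    exact hle hf'
  · rw [eq_top_iff]
    intro f _
    induction f using Finsupp.induction_linear with
    | zero => exact zero_mem _
    | add f g hf hg => exact add_mem (hf trivial) (hg trivial)
    | single i v =>
      have hle : (⨆ q, 𝒱 q) ≤ (⨆ q, 𝒲 q).comap (Finsupp.lsingle i) := by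
        refine iSup_le fun q v hv => Submodule.mem_iSup_of_mem (q - s i) ?_
        rw [hW]
        intro j
        classical
        rw [Finsupp.lsingle_apply, Finsupp.single_apply]
        split_ifs with hij
        · simpa [← hij] using hv
        · exact zero_mem _
      exact hle (ht ▸ Submodule.mem_top)

theorem isInternal_prod {𝒱 : ℤ → Submodule ℂ V} {𝒲 : ℤ → Submodule ℂ W}
    (hV : DirectSum.IsInternal 𝒱) (hW : DirectSum.IsInternal 𝒲) :
    DirectSum.IsInternal fun p => (𝒱 p).prod (𝒲 p) := by
  rw [DirectSum.isInternal_submodule_iff_iSupIndep_and_iSup_eq_top] at hV hW ⊢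
  constructor
  · intro p
    rw [Submodule.disjoint_def]
    intro f hf hf'
    have h₁ : (⨆ (q) (_ : q ≠ p), (𝒱 q).prod (𝒲 q)) ≤
        (⨆ (q) (_ : q ≠ p), 𝒱 q).comap (LinearMap.fst ℂ V W) :=
      iSup₂_le fun q hq f hf => Submodule.mem_iSup_of_mem q (Submodule.mem_iSup_of_mem hq hf.1)
    have h₂ : (⨆ (q) (_ : q ≠ p), (𝒱 q).prod (𝒲 q)) ≤
        (⨆ (q) (_ : q ≠ p), 𝒲 q).comap (LinearMap.snd ℂ V W) :=
      iSup₂_le fun q hq f hf => Submodule.mem_iSup_of_mem q (Submodule.mem_iSup_of_mem hq hf.2)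
    exact Prod.ext (Submodule.disjoint_def.1 (hV.1 p) _ hf.1 (h₁ hf'))
      (Submodule.disjoint_def.1 (hW.1 p) _ hf.2 (h₂ hf'))
  · rw [eq_top_iff]
    rintro ⟨v, w⟩ -
    have h₁ : (⨆ q, 𝒱 q) ≤ (⨆ q, (𝒱 q).prod (𝒲 q)).comap (LinearMap.inl ℂ V W) :=
      iSup_le fun q v hv => Submodule.mem_iSup_of_mem q ⟨hv, zero_mem _⟩
    have h₂ : (⨆ q, 𝒲 q) ≤ (⨆ q, (𝒱 q).prod (𝒲 q)).comap (LinearMap.inr ℂ V W) :=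
      iSup_le fun q v hv => Submodule.mem_iSup_of_mem q ⟨zero_mem _, hv⟩
    have e : ((v, w) : V × W) = (v, 0) + (0, w) := by simp
    rw [e]
    exact add_mem (h₁ (hV.2 ▸ Submodule.mem_top)) (h₂ (hW.2 ▸ Submodule.mem_top))

theorem isInternal_concentrated (r : ℤ) :
    DirectSum.IsInternal fun p : ℤ => (if p = r then ⊤ else ⊥ : Submodule ℂ V) := by
  rw [DirectSum.isInternal_submodule_iff_iSupIndep_and_iSup_eq_top]
  constructor
  · intro p
    by_cases hp : p = r
    · have : (⨆ (q) (_ : q ≠ p), (if q = r then ⊤ else ⊥ : Submodule ℂ V)) = ⊥ := by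
        simp only [iSup_eq_bot]
        intro q hq
        rw [if_neg (hp ▸ hq)]
      rw [this]
      exact disjoint_bot_right
    · simp only [if_neg hp]
      exact disjoint_bot_left
  · rw [eq_top_iff]
    exact le_iSup_of_le r (by simp)

end Internal

/-! ### Normalised signs in a dg Lie algebra with bracket of even degree -/

section EvenBracket

variable {g : Type*} [AddCommGroup g] [Module ℂ g] {N : ℤ} {𝒢 : ℤ → Submodule ℂ g}
  {d : g →ₗ[ℂ] g} {br : g →ₗ[ℂ] g →ₗ[ℂ] g} {form : g →ₗ[ℂ] g →ₗ[ℂ] ℂ} {p q : ℤ} {a b : g}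

theorem IsDGLieAlgebra.d_br_even (hg : IsDGLieAlgebra (-2 * N) 𝒢 d br) (ha : a ∈ 𝒢 p) (b : g) :
    d (br a b) = br (d a) b + (-1 : ℂ) ^ p • br a (d b) := by
  rw [hg.d_br p a b ha, show p + -2 * N = p + 2 * -N by ring, neg_one_zpow_add_shift]

theorem IsDGLieAlgebra.antisymm_even (hg : IsDGLieAlgebra (-2 * N) 𝒢 d br) (ha : a ∈ 𝒢 p)
    (hb : b ∈ 𝒢 q) : br a b = -((-1 : ℂ) ^ (p * q) • br b a) := by
  rw [hg.antisymm p q a b ha hb, show -2 * N = 2 * -N by ring, neg_one_zpow_mul_shift]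

theorem IsDGLieAlgebra.jacobi_even (hg : IsDGLieAlgebra (-2 * N) 𝒢 d br) (ha : a ∈ 𝒢 p)
    (hb : b ∈ 𝒢 q) (c : g) :
    br a (br b c) = br (br a b) c + (-1 : ℂ) ^ (p * q) • br b (br a c) := by
  rw [hg.jacobi p q a b c ha hb, show -2 * N = 2 * -N by ring, neg_one_zpow_mul_shift]

theorem IsInvariantForm.d_form_even (hform : IsInvariantForm (-2 * N) 𝒢 d br form)
    (ha : a ∈ 𝒢 p) (b : g) : form (d a) b + (-1 : ℂ) ^ p * form a (d b) = 0 := by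
  have := hform.d_form p a b ha
  rwa [neg_one_zpow_add_shift] at this

/-- Both sides vanish unless `q = 4N - p`, and then `p` and `p * q` have the same parity. This puts
the symmetry of the form in the sign convention of skew symmetry. -/
theorem IsInvariantForm.symm_even (hform : IsInvariantForm (-2 * N) 𝒢 d br form)
    (ha : a ∈ 𝒢 p) (hb : b ∈ 𝒢 q) : form a b = (-1 : ℂ) ^ (p * q) * form b a := by
  by_cases h : p + q + 2 * (-2 * N) = 0
  · rw [hform.symm p q a b ha hb]
    congr 1
    refine neg_one_zpow_congr ?_
    obtain rfl : q = 4 * N - p := by omega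
    have := Int.even_mul_succ_self p
    have e : p + 2 * (-2 * N) - p * (4 * N - p) = p * (p + 1) + 2 * (-2 * N - 2 * N * p) := by ring
    rw [e]
    exact this.add (even_two_mul _)
  · rw [hform.degree p q a b ha hb h, hform.degree q p b a hb ha (by omega), mul_zero]

/-- Invariance combined with antisymmetry. It supplies the `K`-component of the Jacobi identity,
both for modes and in `ĝ`. -/
theorem IsInvariantForm.form_br_swap (hg : IsDGLieAlgebra (-2 * N) 𝒢 d br)
    (hform : IsInvariantForm (-2 * N) 𝒢 d br form) (ha : a ∈ 𝒢 p) (hb : b ∈ 𝒢 q) (c : g) :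
    (-1 : ℂ) ^ (p * q) * form b (br a c) = -form (br a b) c := by
  rw [hg.antisymm_even ha hb, ← hform.invariant]
  simp

theorem IsInvariantForm.form_eq_zero (hform : IsInvariantForm (-2 * N) 𝒢 d br form)
    (ha : a ∈ 𝒢 p) (hb : b ∈ 𝒢 q) (h : p + q ≠ 4 * N) : form a b = 0 :=
  hform.degree p q a b ha hb (by omega)

end EvenBracket

/-! ### The modes of `ℂ[D] ⊗ g ⊕ ℂK` and the operator `D` -/

section CurrentMode

variable {g : Type*} [AddCommGroup g] [Module ℂ g] {N : ℤ} {𝒢 : ℤ → Submodule ℂ g}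
  {d : g →ₗ[ℂ] g} {br : g →ₗ[ℂ] g →ₗ[ℂ] g} {form : g →ₗ[ℂ] g →ₗ[ℂ] ℂ}

theorem currentD_currentOf (k : ℕ) (a : g) : currentD (currentOf k a) = currentOf (k + 1) a := by
  simp [currentD, currentOf]

theorem currentD_currentK : currentD (currentK : Current g) = 0 := by
  simp [currentD, currentK]

theorem currentDiff_currentOf (k : ℕ) (a : g) :
    currentDiff d (currentOf k a) = currentOf k (d a) := by
  simp [currentDiff, currentOf]

theorem currentDiff_currentK : currentDiff d (currentK : Current g) = 0 := by
  simp [currentDiff, currentK]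

theorem Current.induction_currentOf {P : Current g → Prop} (hK : ∀ c : ℂ, P (c • currentK))
    (hof : ∀ k a, P (currentOf k a)) (hadd : ∀ u v, P u → P v → P (u + v)) (u : Current g) :
    P u := by
  obtain ⟨f, c⟩ := u
  have e : ((f, c) : Current g) = (f, 0) + c • currentK := by simp [currentK]
  rw [e]
  refine hadd _ _ ?_ (hK c)
  clear e
  induction f using Finsupp.induction_linear with
  | zero =>
    have h0 := hK 0
    rwa [zero_smul] at h0
  | add f f' hf hf' => simpa using hadd _ _ hf hf'
  | single k a => exact hof k a

theorem Current.induction_currentD {P : Current g → Prop} (hK : ∀ c : ℂ, P (c • currentK))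
    (hgen : ∀ a, P (currentOf 0 a)) (hD : ∀ u, P u → P (currentD u))
    (hadd : ∀ u v, P u → P v → P (u + v)) (u : Current g) : P u := by
  refine Current.induction_currentOf hK (fun k a => ?_) hadd u
  induction k with
  | zero => exact hgen a
  | succ k ih => exact currentD_currentOf k a ▸ hD _ ih

theorem currentOf_mem {p : ℤ} {k : ℕ} {a : g} (ha : a ∈ 𝒢 (p - 2 * N * k)) :
    currentOf k a ∈ currentDeg N 𝒢 p := by
  refine ⟨fun j => ?_, by simp [currentOf]⟩
  simp only [currentOf, LinearMap.comp_apply, LinearMap.inl_apply, Finsupp.lsingle_apply,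
    Finsupp.single_apply]
  split_ifs with h
  · exact h ▸ ha
  · exact zero_mem _

theorem smul_currentK_mem {p : ℤ} {c : ℂ} (h : p = 0 ∨ c = 0) :
    c • (currentK : Current g) ∈ currentDeg N 𝒢 p := by
  rcases h with rfl | rfl
  · exact ⟨fun j => by simp [currentK], by simp⟩
  · simp

/-- The predicate carries the degree because `D` shifts it and signs depend on it. Multiples of `K`
are required in every degree: the identities proved this way are trivial on `K`, so no degree
bookkeeping is needed there. -/
theorem currentDeg_induction {P : ℤ → Current g → Prop} (hK : ∀ p (c : ℂ), P p (c • currentK))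
    (hgen : ∀ p, ∀ a ∈ 𝒢 p, P p (currentOf 0 a)) (hD : ∀ p u, P p u → P (p + 2 * N) (currentD u))
    (hadd : ∀ p u v, P p u → P p v → P p (u + v)) {p : ℤ} {u : Current g}
    (hu : u ∈ currentDeg N 𝒢 p) : P p u := by
  have hof : ∀ (k : ℕ) (p : ℤ) (a : g), a ∈ 𝒢 (p - 2 * N * k) → P p (currentOf k a) := by
    intro k
    induction k with
    | zero => exact fun p a ha => hgen p a (by simpa using ha)
    | succ k ih =>
      intro p a ha
      have := hD _ _ (ih (p - 2 * N) a (by convert ha using 2; push_cast; ring))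
      rwa [currentD_currentOf, sub_add_cancel] at this
  obtain ⟨f, c⟩ := u
  have e : ((f, c) : Current g) = (f, 0) + c • currentK := by simp [currentK]
  rw [e]
  refine hadd _ _ _ ?_ (hK p c)
  have hf : ∀ k : ℕ, f k ∈ 𝒢 (p - 2 * N * k) := hu.1
  have e' : ((f, 0) : Current g) = ∑ k ∈ f.support, currentOf k (f k) := by
    conv_lhs => rw [← Finsupp.sum_single f]
    exact map_sum (LinearMap.inl ℂ (ℕ →₀ g) ℂ) _ _
  rw [e']
  refine Finset.sum_induction _ (P p) (hadd p) (by simpa using hK p 0) fun k _ => ?_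
  exact hof k p _ (hf k)

theorem currentMode_currentOf (n k l : ℕ) (a b : g) :
    currentMode br form n (currentOf k a) (currentOf l b) =
      ((-1 : ℂ) ^ k * k.factorial * l.factorial * n.choose k) •
        ∑ i ∈ Finset.range (l + 1), (((n - k).choose i : ℂ) * ((l - i).factorial : ℂ)⁻¹) •
          (currentD ^ (l - i)) (generatorMode br form (n - k - i) a b) := by
  simp [currentMode, currentOf, LinearMap.sum_apply]

/-- `(D u)_(n) = -n u_(n-1)`. -/
theorem currentMode_currentD_left (n : ℕ) (u v : Current g) :
    currentMode br form n (currentD u) v = -((n : ℂ) • currentMode br form (n - 1) u v) := by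
  induction u using Current.induction_currentOf with
  | hK c => simp [currentMode_K_left, currentD_currentK]
  | hadd u u' hu hu' => simp only [map_add, LinearMap.add_apply, hu, hu', smul_add, neg_add]
  | hof k a =>
    induction v using Current.induction_currentOf with
    | hK c => simp [currentMode_K_right]
    | hadd v v' hv hv' => simp only [map_add, hv, hv', smul_add, neg_add]
    | hof l b =>
      rw [currentD_currentOf, currentMode_currentOf, currentMode_currentOf, smul_smul, ← neg_smul]
      -- For `n = 0` the truncated index `n - 1` is harmless: its coefficient is `n`, and `0.choose
      -- (k + 1)` vanishes on the other side.
      rcases n with _ | n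
      · simp
      · have e : n + 1 - (k + 1) = n + 1 - 1 - k := by omega
        rw [e]
        congr 1
        have h := Nat.add_one_mul_choose_eq n k
        have h' : ((n : ℂ) + 1) * n.choose k = (n + 1).choose (k + 1) * (k + 1) := by
          exact_mod_cast h
        rw [Nat.factorial_succ, pow_succ, Nat.add_sub_cancel]
        push_cast
        linear_combination ((-1 : ℂ) ^ k * k.factorial * l.factorial) * h'

theorem currentMode_zero_currentD_left (u v : Current g) :
    currentMode br form 0 (currentD u) v = 0 := by
  simp [currentMode_currentD_left]

/-- `a_(n) (D v) = D (a_(n) v) + n a_(n-1) v` on generators. -/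
theorem currentMode_generator_currentD (n l : ℕ) (a b : g) :
    currentMode br form n (currentOf 0 a) (currentD (currentOf l b)) =
      currentD (currentMode br form n (currentOf 0 a) (currentOf l b)) +
        (n : ℂ) • currentMode br form (n - 1) (currentOf 0 a) (currentOf l b) := by
  -- The three expressions are `l!` times sums of the same vectors `x j`, with weights `l + 1`, `l +
  -- 1 - j` and `j`. The term `j = l + 1` of the second and the term `j = 0` of the third vanish, so
  -- all may range over `j ≤ l + 1`.
  set x : ℕ → Current g := fun j => ((n.choose j : ℂ) * ((l + 1 - j).factorial : ℂ)⁻¹) •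
          (currentD ^ (l + 1 - j)) (generatorMode br form (n - j) a b) with hx
  have h1 : currentMode br form n (currentOf 0 a) (currentD (currentOf l b)) =
      (l.factorial : ℂ) • ∑ j ∈ Finset.range (l + 2), ((l : ℂ) + 1) • x j := by
    rw [currentD_currentOf, currentMode_currentOf, ← Finset.smul_sum, smul_smul]
    simp [hx, Nat.factorial_succ, mul_comm]
  have h2 : currentD (currentMode br form n (currentOf 0 a) (currentOf l b)) =
      (l.factorial : ℂ) • ∑ j ∈ Finset.range (l + 2), ((l : ℂ) + 1 - j) • x j := by
    rw [Finset.sum_range_succ, currentMode_currentOf, map_smul, map_sum]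
    simp only [pow_zero, Nat.factorial_zero, Nat.choose_zero_right, Nat.cast_one, mul_one, one_mul,
      Nat.sub_zero]
    push_cast
    rw [sub_self, zero_smul, add_zero]
    congr 1
    refine Finset.sum_congr rfl fun i hi => ?_
    have hi : i ≤ l := by simpa [Nat.lt_succ_iff] using hi
    rw [hx, map_smul, smul_smul, ← Module.End.mul_apply, ← pow_succ',
      show l + 1 - i = l - i + 1 by omega]
    congr 1
    rw [Nat.factorial_succ]
    have : ((l - i : ℕ) : ℂ) = l - i := by push_cast [hi]; ring
    push_cast
    rw [this]
    have h0 : (l : ℂ) - i + 1 ≠ 0 := by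
      rw [← this]
      exact_mod_cast Nat.succ_ne_zero (l - i)
    have h3 : (l : ℂ) + 1 - i ≠ 0 := by
      intro h
      exact h0 (by rw [← h]; ring)
    have h4 : ((l - i).factorial : ℂ) ≠ 0 := by exact_mod_cast Nat.factorial_ne_zero _
    field_simp
    ring
  have h3 : (n : ℂ) • currentMode br form (n - 1) (currentOf 0 a) (currentOf l b) =
      (l.factorial : ℂ) • ∑ j ∈ Finset.range (l + 2), (j : ℂ) • x j := by
    rw [Finset.sum_range_succ', currentMode_currentOf, smul_comm]
    simp only [pow_zero, Nat.factorial_zero, Nat.choose_zero_right, Nat.cast_one, mul_one, one_mul,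
      Nat.sub_zero]
    rw [Nat.cast_zero, zero_smul, add_zero, Finset.smul_sum]
    congr 1
    refine Finset.sum_congr rfl fun i _ => ?_
    rw [hx]
    dsimp only
    rw [smul_smul, smul_smul, Nat.add_sub_add_right, show n - 1 - i = n - (i + 1) by omega]
    congr 1
    rcases n with _ | n
    · simp
    · have h' : ((n : ℂ) + 1) * n.choose i = (n + 1).choose (i + 1) * (i + 1) := by
        exact_mod_cast Nat.add_one_mul_choose_eq n i
      rw [Nat.add_sub_cancel]
      push_cast
      linear_combination ((l - i).factorial : ℂ)⁻¹ * h'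
  rw [h1, h2, h3, ← smul_add, ← Finset.sum_add_distrib]
  congr 1
  refine Finset.sum_congr rfl fun i _ => ?_
  rw [← add_smul, sub_add_cancel]

/-- `u_(n) (D v) = D (u_(n) v) + n u_(n-1) v`. -/
theorem currentMode_currentD_right (n : ℕ) (u v : Current g) :
    currentMode br form n u (currentD v) =
      currentD (currentMode br form n u v) + (n : ℂ) • currentMode br form (n - 1) u v := by
  induction u using Current.induction_currentD generalizing n with
  | hK c => simp [currentMode_K_left]
  | hadd u u' hu hu' =>
    simp only [map_add, LinearMap.add_apply, hu, hu', smul_add]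
    abel
  | hD u hu =>
    simp only [currentMode_currentD_left, hu, map_neg, map_smul, smul_add, neg_add, smul_neg]
  | hgen a =>
    induction v using Current.induction_currentOf with
    | hK c => simp [currentMode_K_right, currentD_currentK]
    | hadd v v' hv hv' =>
      simp only [map_add, hv, hv', smul_add]
      abel
    | hof l b => exact currentMode_generator_currentD n l a b

end CurrentMode

/-! ### Degrees, differential and truncation for the modes of `U` -/

section CurrentVertex

variable {g : Type*} [AddCommGroup g] [Module ℂ g] {N : ℤ} {𝒢 : ℤ → Submodule ℂ g}
  {d : g →ₗ[ℂ] g} {br : g →ₗ[ℂ] g →ₗ[ℂ] g} {form : g →ₗ[ℂ] g →ₗ[ℂ] ℂ}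

theorem generatorMode_zero (a b : g) : generatorMode br form 0 a b = currentOf 0 (br a b) := rfl

theorem generatorMode_one (a b : g) : generatorMode br form 1 a b = form a b • currentK := by
  simp [generatorMode, currentK]

theorem generatorMode_add_two (n : ℕ) (a b : g) : generatorMode br form (n + 2) a b = 0 := rfl

theorem currentDeg_isCochainComplex (hg : IsCochainComplex 𝒢 d) :
    IsCochainComplex (currentDeg N 𝒢) (currentDiff d) where
  isInternal := isInternal_prod
    (isInternal_finsupp hg.isInternal (fun k : ℕ => -(2 * N * k)) _ fun _ _ => Iff.rfl)
    (isInternal_concentrated 0)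
  d_mem p v hv := by
    refine ⟨fun k => ?_, by simp [currentDiff]⟩
    have := hg.d_mem _ _ (hv.1 k)
    rw [show p - 2 * N * k + 1 = p + 1 - 2 * N * k by ring] at this
    simpa [currentDiff] using this
  d_d v := by
    ext
    · simp [currentDiff, hg.d_d]
    · simp [currentDiff]

theorem currentD_mem {p : ℤ} {u : Current g} (hu : u ∈ currentDeg N 𝒢 p) :
    currentD u ∈ currentDeg N 𝒢 (p + 2 * N) := by
  refine ⟨fun k => ?_, by simp [currentD]⟩
  change Finsupp.mapDomain (fun k => k + 1) u.1 k ∈ _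
  rcases k with _ | k
  · rw [Finsupp.mapDomain_of_notMem_range _ _ (by simp)]
    exact zero_mem _
  · rw [Finsupp.mapDomain_apply (add_left_injective 1)]
    have := hu.1 k
    rw [show p - 2 * N * k = p + 2 * N - 2 * N * (k + 1 : ℕ) by push_cast; ring] at this
    exact this

theorem currentD_currentDiff (u : Current g) :
    currentD (currentDiff d u) = currentDiff d (currentD u) := by
  induction u using Current.induction_currentOf with
  | hK c => simp [currentDiff_currentK, currentD_currentK]
  | hadd u v hu hv => simp only [map_add, hu, hv]
  | hof k a => simp only [currentD_currentOf, currentDiff_currentOf]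

theorem currentD_currentD_pow (k : ℕ) (u : Current g) :
    currentD ((currentD ^ k) u) = (currentD ^ (k + 1)) u := by
  rw [pow_succ', Module.End.mul_apply]

theorem currentD_pow_currentD (k : ℕ) (u : Current g) :
    (currentD ^ k) (currentD u) = (currentD ^ (k + 1)) u := by
  rw [pow_succ, Module.End.mul_apply]

theorem currentMode_mem (hg : IsDGLieAlgebra (-2 * N) 𝒢 d br)
    (hform : IsInvariantForm (-2 * N) 𝒢 d br form) {p q : ℤ} {u v : Current g}
    (hu : u ∈ currentDeg N 𝒢 p) (hv : v ∈ currentDeg N 𝒢 q) (n : ℕ) :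
    currentMode br form n u v ∈ currentDeg N 𝒢 (p + q - 2 * N * (n + 1)) := by
  revert n
  refine currentDeg_induction (P := fun p u => ∀ n : ℕ,
    currentMode br form n u v ∈ currentDeg N 𝒢 (p + q - 2 * N * (n + 1))) ?_ ?_ ?_ ?_ hu
  · intro p c n
    simp [currentMode_K_left]
  · intro p a ha
    refine currentDeg_induction (P := fun q v => ∀ n : ℕ, currentMode br form n (currentOf 0 a) v ∈
      currentDeg N 𝒢 (p + q - 2 * N * (n + 1))) ?_ ?_ ?_ ?_ hv
    · intro q c n
      simp [currentMode_K_right]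
    · intro q b hb n
      rw [currentMode_generators]
      match n with
      | 0 =>
        refine currentOf_mem ?_
        convert hg.br_mem p q a b ha hb using 2
        push_cast
        ring
      | 1 =>
        rw [generatorMode_one]
        refine smul_currentK_mem ?_
        -- `⟨a, b⟩ K` is expected in degree `p + q - 4N`, which is the degree 0 of `K` exactly when
        -- the form is allowed to be nonzero.
        by_cases h : p + q = 4 * N
        · left
          push_cast
          linear_combination h
        · exact Or.inr (hform.form_eq_zero ha hb h)
      | n + 2 => exact zero_mem _
    · intro q v ih n
      rw [currentMode_currentD_right]
      refine add_mem ?_ ?_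
      · convert currentD_mem (ih n) using 2
        ring
      · rcases n with _ | n
        · simp
        · refine Submodule.smul_mem _ _ ?_
          rw [Nat.add_sub_cancel]
          convert ih n using 2
          push_cast
          ring
    · intro q v v' h h' n
      rw [map_add]
      exact add_mem (h n) (h' n)
  · intro p u ih n
    rw [currentMode_currentD_left]
    rcases n with _ | n
    · simp
    · refine neg_mem (Submodule.smul_mem _ _ ?_)
      rw [Nat.add_sub_cancel]
      convert ih n using 2
      push_cast
      ring
  · intro p u u' h h' n
    rw [map_add, LinearMap.add_apply]
    exact add_mem (h n) (h' n)

/-- On generators, mode 0 is the Leibniz rule for the bracket and mode 1 the compatibility of the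
form with `d`. The rule propagates because `D` commutes with `d` and has even degree. -/
theorem currentDiff_currentMode (hg : IsDGLieAlgebra (-2 * N) 𝒢 d br)
    (hform : IsInvariantForm (-2 * N) 𝒢 d br form) {p : ℤ} {u : Current g}
    (hu : u ∈ currentDeg N 𝒢 p) (n : ℕ) (v : Current g) :
    currentDiff d (currentMode br form n u v) = currentMode br form n (currentDiff d u) v +
      (-1 : ℂ) ^ p • currentMode br form n u (currentDiff d v) := by
  revert n v
  refine currentDeg_induction (P := fun p u => ∀ (n : ℕ) (v : Current g),
    currentDiff d (currentMode br form n u v) = currentMode br form n (currentDiff d u) v +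
      (-1 : ℂ) ^ p • currentMode br form n u (currentDiff d v)) ?_ ?_ ?_ ?_ hu
  · intro p c n v
    simp [currentMode_K_left, currentDiff_currentK]
  · intro p a ha n v
    induction v using Current.induction_currentD generalizing n with
    | hK c => simp [currentMode_K_right, currentDiff_currentK]
    | hadd v v' hv hv' =>
      simp only [map_add, hv, hv', smul_add]
      abel
    | hD v hv =>
      simp only [← currentD_currentDiff, currentMode_currentD_right, map_add, map_smul, hv,
        smul_add, smul_comm (n : ℂ)]
      abel
    | hgen b =>
      simp only [currentDiff_currentOf, currentMode_generators]
      match n with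
      | 0 =>
        simp only [generatorMode_zero, currentDiff_currentOf, hg.d_br_even ha, map_add, map_smul]
      | 1 =>
        simp only [generatorMode_one, map_smul, currentDiff_currentK, smul_zero, smul_smul]
        rw [← add_smul, hform.d_form_even ha, zero_smul]
      | n + 2 => simp [generatorMode_add_two]
  · intro p u ih n v
    simp only [← currentD_currentDiff, currentMode_currentD_left, map_neg, map_smul, ih,
      neg_one_zpow_add_shift, smul_add, smul_neg, neg_add, smul_comm (n : ℂ)]
  · intro p u u' h h' n v
    simp only [map_add, LinearMap.add_apply, h, h', smul_add]
    abel

/-- Modes of index at least 2 vanish on generators, and each application of `D` to either argument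
raises the bound by one. -/
theorem currentMode_truncation (u v : Current g) :
    ∃ n₀ : ℕ, ∀ n : ℕ, n₀ ≤ n → currentMode br form n u v = 0 := by
  induction u using Current.induction_currentD with
  | hK c => exact ⟨0, fun n _ => by simp [currentMode_K_left]⟩
  | hadd u u' hu hu' =>
    obtain ⟨m, hm⟩ := hu
    obtain ⟨m', hm'⟩ := hu'
    exact ⟨max m m', fun n hn => by
      rw [map_add, LinearMap.add_apply, hm n (by omega), hm' n (by omega), add_zero]⟩
  | hD u hu =>
    obtain ⟨m, hm⟩ := hu
    exact ⟨m + 1, fun n hn => by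
      rw [currentMode_currentD_left, hm (n - 1) (by omega), smul_zero, neg_zero]⟩
  | hgen a =>
    induction v using Current.induction_currentD with
    | hK c => exact ⟨0, fun n _ => by simp [currentMode_K_right]⟩
    | hadd u u' hu hu' =>
      obtain ⟨m, hm⟩ := hu
      obtain ⟨m', hm'⟩ := hu'
      exact ⟨max m m', fun n hn => by
        rw [map_add, hm n (by omega), hm' n (by omega), add_zero]⟩
    | hD u hu =>
      obtain ⟨m, hm⟩ := hu
      exact ⟨m + 1, fun n hn => by
        rw [currentMode_currentD_right, hm (n - 1) (by omega), hm n (by omega), smul_zero,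
          map_zero, add_zero]⟩
    | hgen b =>
      refine ⟨2, fun n hn => ?_⟩
      obtain ⟨n, rfl⟩ := Nat.exists_eq_add_of_le' hn
      rw [currentMode_generators, generatorMode_add_two]

/-! ### Half skew symmetry -/

/-- The partial sums of the coefficient of `x ^ (-n-1)` in `-e^(xD) Y⁻(v, -x) u`. -/
def skewSum (br : g →ₗ[ℂ] g →ₗ[ℂ] g) (form : g →ₗ[ℂ] g →ₗ[ℂ] ℂ) (M n : ℕ) (v u : Current g) :
    Current g :=
  ∑ k ∈ Finset.range M, ((-1 : ℂ) ^ (n + k) * (k.factorial : ℂ)⁻¹) •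
    (currentD ^ k) (currentMode br form (n + k) v u)

theorem skewSum_add_left (M n : ℕ) (v v' u : Current g) :
    skewSum br form M n (v + v') u = skewSum br form M n v u + skewSum br form M n v' u := by
  simp [skewSum, Finset.sum_add_distrib]

theorem skewSum_add_right (M n : ℕ) (v u u' : Current g) :
    skewSum br form M n v (u + u') = skewSum br form M n v u + skewSum br form M n v u' := by
  simp [skewSum, Finset.sum_add_distrib]

/-- The auxiliary term `∑ (-1)^(n+k) / k! D^k (v_(n+k-1) u)` with a weight `w k`. -/
def weightedSkewSum (br : g →ₗ[ℂ] g →ₗ[ℂ] g) (form : g →ₗ[ℂ] g →ₗ[ℂ] ℂ) (w : ℕ → ℂ) (M n : ℕ)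
    (v u : Current g) : Current g :=
  ∑ k ∈ Finset.range M, (w k * ((-1 : ℂ) ^ (n + k) * (k.factorial : ℂ)⁻¹)) •
    (currentD ^ k) (currentMode br form (n + k - 1) v u)

/-- Moving `D` through the mode of index `n + k` produces the weight `n + k`, whose two summands are
treated separately. The constant `n` lowers the index of the skew sum by one; the weight `k` cancels
against `1 / k!` and, after reindexing, leaves `D` applied to a sum with one term fewer. -/
theorem weightedSkewSum_const (M n : ℕ) (v u : Current g) :
    weightedSkewSum br form (fun _ => n) M n v u = -((n : ℂ) • skewSum br form M (n - 1) v u) := by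
  rcases n with _ | n
  · simp [weightedSkewSum]
  · rw [weightedSkewSum, skewSum, Finset.smul_sum, ← Finset.sum_neg_distrib]
    refine Finset.sum_congr rfl fun k _ => ?_
    rw [Nat.add_sub_cancel, show n + 1 + k - 1 = n + k by omega, smul_smul, ← neg_smul]
    congr 1
    ring

theorem weightedSkewSum_id (M n : ℕ) (v u : Current g) :
    weightedSkewSum br form (fun k => k) (M + 1) n v u = -currentD (skewSum br form M n v u) := by
  rw [weightedSkewSum, Finset.sum_range_succ', skewSum, map_sum, ← Finset.sum_neg_distrib]
  simp only [Nat.cast_zero, zero_mul, zero_smul, add_zero]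
  refine Finset.sum_congr rfl fun k _ => ?_
  rw [map_smul, currentD_currentD_pow, ← neg_smul, Nat.factorial_succ,
    show n + (k + 1) - 1 = n + k by omega]
  congr 1
  have h0 : (k : ℂ) + 1 ≠ 0 := by exact_mod_cast Nat.succ_ne_zero k
  have h1 : (k.factorial : ℂ) ≠ 0 := by exact_mod_cast Nat.factorial_ne_zero _
  push_cast
  field_simp
  ring

theorem weightedSkewSum_add (w w' : ℕ → ℂ) (M n : ℕ) (v u : Current g) :
    weightedSkewSum br form (fun k => w k + w' k) M n v u =
      weightedSkewSum br form w M n v u + weightedSkewSum br form w' M n v u := by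
  simp [weightedSkewSum, add_mul, add_smul, Finset.sum_add_distrib]

theorem skewSum_currentD_left (M n : ℕ) (v u : Current g) :
    skewSum br form (M + 1) n (currentD v) u =
      (n : ℂ) • skewSum br form (M + 1) (n - 1) v u + currentD (skewSum br form M n v u) := by
  have h : skewSum br form (M + 1) n (currentD v) u =
      -weightedSkewSum br form (fun k => n + k) (M + 1) n v u := by
    rw [weightedSkewSum, skewSum, ← Finset.sum_neg_distrib]
    refine Finset.sum_congr rfl fun k _ => ?_
    rw [currentMode_currentD_left, map_neg, map_smul, smul_neg, smul_smul]
    push_cast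
    rw [mul_comm]
  rw [h, weightedSkewSum_add, weightedSkewSum_const, weightedSkewSum_id, neg_add, neg_neg, neg_neg]

/-- The part with weight `k` cancels the derivative of the skew sum, but only up to its top term;
truncation is what removes that term. -/
theorem skewSum_currentD_right {M : ℕ} {v u : Current g}
    (hM : ∀ j, M ≤ j → currentMode br form j v u = 0) (n : ℕ) :
    skewSum br form (M + 1) n v (currentD u) = -((n : ℂ) • skewSum br form (M + 1) (n - 1) v u) := by
  have h : skewSum br form (M + 1) n v (currentD u) = currentD (skewSum br form (M + 1) n v u) +
      weightedSkewSum br form (fun k => n + k) (M + 1) n v u := by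
    rw [weightedSkewSum, skewSum, skewSum, map_sum, ← Finset.sum_add_distrib]
    refine Finset.sum_congr rfl fun k _ => ?_
    rw [currentMode_currentD_right, map_add, smul_add, map_smul, map_smul, smul_smul,
      currentD_currentD_pow, currentD_pow_currentD]
    push_cast
    rw [mul_comm (_ * _) ((n : ℂ) + k)]
  have h' : skewSum br form (M + 1) n v u = skewSum br form M n v u := by
    rw [skewSum, Finset.sum_range_succ, hM (n + M) (by omega), map_zero, smul_zero, add_zero,
      skewSum]
  rw [h, weightedSkewSum_add, weightedSkewSum_const, weightedSkewSum_id, h']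
  abel

theorem generatorMode_skew (hg : IsDGLieAlgebra (-2 * N) 𝒢 d br)
    (hform : IsInvariantForm (-2 * N) 𝒢 d br form) {p q : ℤ} {a b : g} (ha : a ∈ 𝒢 p)
    (hb : b ∈ 𝒢 q) (n : ℕ) : generatorMode br form n a b =
      -((-1 : ℂ) ^ (p * q) • (-1 : ℂ) ^ n • generatorMode br form n b a) := by
  match n with
  | 0 =>
    rw [generatorMode_zero, generatorMode_zero, hg.antisymm_even ha hb, pow_zero, one_smul,
      map_neg, map_smul]
  | 1 =>
    rw [generatorMode_one, generatorMode_one, hform.symm_even ha hb, pow_one, neg_one_smul,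
      smul_neg, neg_neg, smul_smul]
  | n + 2 => simp only [generatorMode_add_two, smul_zero, neg_zero]

/-- The claim is made for all large `M` because the rules for `D` relate partial sums of lengths `M`
and `M + 1`, so the induction hypothesis is needed at both. -/
theorem currentMode_skew (hg : IsDGLieAlgebra (-2 * N) 𝒢 d br)
    (hform : IsInvariantForm (-2 * N) 𝒢 d br form) {p q : ℤ} {u v : Current g}
    (hu : u ∈ currentDeg N 𝒢 p) (hv : v ∈ currentDeg N 𝒢 q) :
    ∃ M₀ : ℕ, ∀ M, M₀ ≤ M → ∀ n,
      currentMode br form n u v = -((-1 : ℂ) ^ (p * q) • skewSum br form M n v u) := by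
  refine currentDeg_induction (P := fun p u => ∃ M₀ : ℕ, ∀ M, M₀ ≤ M → ∀ n,
      currentMode br form n u v = -((-1 : ℂ) ^ (p * q) • skewSum br form M n v u)) ?_ ?_ ?_ ?_ hu
  · intro p c
    exact ⟨0, fun M _ n => by simp [skewSum, currentMode_K_left, currentMode_K_right]⟩
  · intro p a ha
    refine currentDeg_induction (P := fun q v => ∃ M₀ : ℕ, ∀ M, M₀ ≤ M → ∀ n,
      currentMode br form n (currentOf 0 a) v =
        -((-1 : ℂ) ^ (p * q) • skewSum br form M n v (currentOf 0 a))) ?_ ?_ ?_ ?_ hv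
    · intro q c
      exact ⟨0, fun M _ n => by simp [skewSum, currentMode_K_left, currentMode_K_right]⟩
    · intro q b hb
      refine ⟨2, fun M hM n => ?_⟩
      have hs : skewSum br form M n (currentOf 0 b) (currentOf 0 a) =
          (-1 : ℂ) ^ n • generatorMode br form n b a := by
        obtain ⟨M, rfl⟩ := Nat.exists_eq_add_of_le' hM
        rw [skewSum, Finset.sum_range_succ', Finset.sum_eq_zero, zero_add]
        · simp [currentMode_generators]
        · intro k _
          rw [currentMode_generators]
          -- The terms beyond `k = 0` involve modes of positive index. Mode 1 gives a multiple of
          -- `K`, killed by `D`, and higher modes are zero.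
          rcases n with _ | n
          · rcases k with _ | k
            · simp [generatorMode_one, currentD_currentK]
            · rw [show 0 + (k + 1 + 1) = k + 2 by omega, generatorMode_add_two]
              simp
          · rw [show n + 1 + (k + 1) = n + k + 2 by omega, generatorMode_add_two]
            simp
      rw [hs, currentMode_generators, generatorMode_skew hg hform ha hb]
    · rintro q v ⟨M₀, h⟩
      refine ⟨M₀ + 1, fun M hM n => ?_⟩
      obtain ⟨M, rfl⟩ := Nat.exists_eq_add_of_le' (show 1 ≤ M by omega)
      -- `D` has even degree `2N`, so replacing `v` by `D v` leaves the sign unchanged.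
      have e := neg_one_zpow_mul_shift p q 0 N
      rw [mul_zero, add_zero] at e
      rw [skewSum_currentD_left, currentMode_currentD_right, e, h M (by omega),
        h (M + 1) (by omega) (n - 1), map_neg, map_smul, smul_add, smul_neg,
        smul_comm (n : ℂ)]
      abel
    · rintro q v v' ⟨M₀, h⟩ ⟨M₁, h'⟩
      refine ⟨max M₀ M₁, fun M hM n => ?_⟩
      rw [map_add, h M (by omega), h' M (by omega), skewSum_add_left, smul_add, neg_add]
  · rintro p u ⟨M₀, h⟩
    obtain ⟨M₁, h₁⟩ := currentMode_truncation (br := br) (form := form) v u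
    refine ⟨max M₀ M₁ + 1, fun M hM n => ?_⟩
    obtain ⟨M, rfl⟩ := Nat.exists_eq_add_of_le' (show 1 ≤ M by omega)
    have e := neg_one_zpow_mul_shift p q N 0
    rw [mul_zero, add_zero] at e
    rw [skewSum_currentD_right (fun j hj => h₁ j (by omega)), currentMode_currentD_left, e,
      h (M + 1) (by omega) (n - 1), smul_neg, smul_neg, smul_comm (n : ℂ)]
  · rintro p u u' ⟨M₀, h⟩ ⟨M₁, h'⟩
    refine ⟨max M₀ M₁, fun M hM n => ?_⟩
    rw [map_add, LinearMap.add_apply, h M (by omega), h' M (by omega), skewSum_add_right, smul_add,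
      neg_add]

/-! ### The commutator formula -/

/-- The expected central term `m ⟨a, b⟩ K_(m+n-1)` is absent because `K` has no modes. After
reducing `w` to a generator, the modes (0, 0) give the Jacobi identity, (1, 0) and (0, 1) invariance
of the form, and in all other cases every term vanishes. -/
theorem currentMode_generators_commutator (hg : IsDGLieAlgebra (-2 * N) 𝒢 d br)
    (hform : IsInvariantForm (-2 * N) 𝒢 d br form) {p q : ℤ} {a b : g} (ha : a ∈ 𝒢 p)
    (hb : b ∈ 𝒢 q) (w : Current g) (m n : ℕ) :
    currentMode br form m (currentOf 0 a) (currentMode br form n (currentOf 0 b) w) =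
      currentMode br form (m + n) (currentOf 0 (br a b)) w + (-1 : ℂ) ^ (p * q) •
        currentMode br form n (currentOf 0 b) (currentMode br form m (currentOf 0 a) w) := by
  induction w using Current.induction_currentD generalizing m n with
  | hK c => simp [currentMode_K_right]
  | hadd w w' h h' =>
    simp only [map_add, h, h', smul_add]
    abel
  | hD w h =>
    -- This is `m + n` split as a sum of two weights; the zero cases are separate because `m - 1`
    -- and `n - 1` are truncated, and there the weight kills the offending term.
    have e : ((m + n : ℕ) : ℂ) • currentMode br form (m + n - 1) (currentOf 0 (br a b)) w =
        (m : ℂ) • currentMode br form (m - 1 + n) (currentOf 0 (br a b)) w +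
        (n : ℂ) • currentMode br form (m + (n - 1)) (currentOf 0 (br a b)) w := by
      rcases m with _ | m
      · simp
      rcases n with _ | n
      · simp
      rw [show m + 1 - 1 + (n + 1) = m + 1 + (n + 1) - 1 by omega,
        show m + 1 + (n + 1 - 1) = m + 1 + (n + 1) - 1 by omega, ← add_smul]
      push_cast
      rfl
    simp only [currentMode_currentD_right, map_add, map_smul, h, e, smul_add,
      smul_comm ((-1 : ℂ) ^ (p * q))]
    abel
  | hgen c =>
    simp only [currentMode_generators]
    match m, n with
    | 0, 0 =>
      simp only [generatorMode_zero, currentMode_generators, hg.jacobi_even ha hb c, map_add,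
        map_smul, add_zero]
    | 1, 0 =>
      simp [generatorMode_zero, generatorMode_one, currentMode_generators, currentMode_K_right,
        hform.invariant]
    | 0, 1 =>
      simp only [generatorMode_zero, generatorMode_one, currentMode_generators,
        currentMode_K_right, map_smul, smul_smul, hform.form_br_swap hg ha hb, zero_add]
      simp
    | m + 2, 0 =>
      simp [generatorMode_zero, generatorMode_add_two, currentMode_generators]
    | 0, n + 2 =>
      simp [generatorMode_zero, generatorMode_add_two, currentMode_generators]
    | 1, 1 => simp [generatorMode_one, generatorMode_add_two, currentMode_K_right]
    | 1, n + 2 =>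
      rw [show 1 + (n + 2) = n + 1 + 2 by omega]
      simp [generatorMode_one, generatorMode_add_two, currentMode_K_right]
    | m + 2, 1 =>
      rw [show m + 2 + 1 = m + 1 + 2 by omega]
      simp [generatorMode_one, generatorMode_add_two, currentMode_K_right]
    | m + 2, n + 2 =>
      rw [show m + 2 + (n + 2) = m + n + 2 + 2 by omega]
      simp [generatorMode_add_two]

/-- `∑_{i ≤ m} (m choose i) (u_(l+i) v)_(m+n-i) w`. -/
def iterateSum (br : g →ₗ[ℂ] g →ₗ[ℂ] g) (form : g →ₗ[ℂ] g →ₗ[ℂ] ℂ) (u v w : Current g)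
    (l m n : ℕ) : Current g :=
  ∑ i ∈ Finset.range (m + 1), (m.choose i : ℂ) •
    currentMode br form (m + n - i) (currentMode br form (l + i) u v) w

theorem iterateSum_currentD_left (u v w : Current g) (m n : ℕ) :
    iterateSum br form (currentD u) v w 0 m n =
      -((m : ℂ) • iterateSum br form u v w 0 (m - 1) n) := by
  rcases m with _ | m
  · simp [iterateSum, currentMode_currentD_left]
  · rw [iterateSum, Finset.sum_range_succ', iterateSum, Finset.smul_sum, ← Finset.sum_neg_distrib]
    -- `(D u)_(0) = 0` removes the term `i = 0`, so the sum can be reindexed by `i + 1`.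
    simp only [zero_add, currentMode_zero_currentD_left, map_zero, LinearMap.zero_apply, smul_zero,
      add_zero]
    refine Finset.sum_congr rfl fun i _ => ?_
    have h : ((m : ℂ) + 1) * m.choose i = (m + 1).choose (i + 1) * (i + 1) := by
      exact_mod_cast Nat.add_one_mul_choose_eq m i
    rw [currentMode_currentD_left, show m + 1 + n - (i + 1) = m + 1 - 1 + n - i by omega]
    simp only [map_neg, map_smul, LinearMap.neg_apply, LinearMap.smul_apply, Nat.add_sub_cancel]
    rw [smul_neg, smul_smul, smul_smul]
    push_cast
    rw [h]

theorem iterateSum_currentD_right (u v w : Current g) (m n : ℕ) :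
    iterateSum br form u (currentD v) w 0 m n =
      -((n : ℂ) • iterateSum br form u v w 0 m (n - 1)) := by
  -- Expanding `u_(i) (D v)` gives `y i` with weight `-(m + n - i) (m choose i)`, plus a sum in
  -- `u_(i-1) v` that becomes weight `(m - i) (m choose i)` after a shift of `i`. The total is `-n
  -- (m choose i)`.
  set y : ℕ → Current g := fun i =>
    currentMode br form (m + n - i - 1) (currentMode br form i u v) w with hy
  have h1 : iterateSum br form u (currentD v) w 0 m n =
      (∑ i ∈ Finset.range (m + 1), (-(((m : ℂ) + n - i) * m.choose i)) • y i) +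
      ∑ i ∈ Finset.range (m + 1), ((i : ℂ) * m.choose i) •
        currentMode br form (m + n - i) (currentMode br form (i - 1) u v) w := by
    rw [iterateSum, ← Finset.sum_add_distrib]
    refine Finset.sum_congr rfl fun i hi => ?_
    have hi : i ≤ m + n := by
      have := Finset.mem_range.1 hi
      omega
    rw [zero_add, currentMode_currentD_right, map_add, LinearMap.add_apply,
      currentMode_currentD_left, map_smul, LinearMap.smul_apply, smul_add, smul_neg, smul_smul,
      smul_smul, neg_smul, mul_comm (m.choose i : ℂ), mul_comm (m.choose i : ℂ)]
    push_cast [hi]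
    rfl
  have h2 : ∑ i ∈ Finset.range (m + 1), ((i : ℂ) * m.choose i) •
        currentMode br form (m + n - i) (currentMode br form (i - 1) u v) w =
      ∑ i ∈ Finset.range (m + 1), (((m : ℂ) - i) * m.choose i) • y i := by
    rw [Finset.sum_range_succ', Finset.sum_range_succ]
    simp only [Nat.cast_zero, zero_mul, zero_smul, add_zero, sub_self]
    refine Finset.sum_congr rfl fun i hi => ?_
    have h : ((m - i : ℕ) : ℂ) = m - i := by
      rw [Nat.cast_sub (Finset.mem_range.1 hi).le]
    have h' : (m.choose (i + 1) : ℂ) * (i + 1) = m.choose i * (m - i : ℕ) := by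
      exact_mod_cast Nat.choose_succ_right_eq m i
    rw [← h, mul_comm _ (m.choose i : ℂ), ← h', mul_comm, Nat.add_sub_cancel, Nat.sub_add_eq]
    push_cast
    rfl
  have h3 : -((n : ℂ) • iterateSum br form u v w 0 m (n - 1)) =
      ∑ i ∈ Finset.range (m + 1), (-((n : ℂ) * m.choose i)) • y i := by
    rcases n with _ | n
    · simp
    · rw [iterateSum, Finset.smul_sum, ← Finset.sum_neg_distrib]
      refine Finset.sum_congr rfl fun i _ => ?_
      rw [hy]
      dsimp only
      rw [smul_smul, neg_smul, zero_add, show m + (n + 1) - i - 1 = m + (n + 1 - 1) - i by omega]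
  rw [h1, h2, h3, ← Finset.sum_add_distrib]
  refine Finset.sum_congr rfl fun i _ => ?_
  rw [← add_smul]
  congr 1
  ring

/-- Both sides transform alike under `u ↦ D u` and `v ↦ D v`, so generators suffice. There only the
term `i = 0` of the iterate survives: `i = 1` is a mode of a multiple of `K`, and later terms
contain a vanishing product. -/
theorem currentMode_commutator (hg : IsDGLieAlgebra (-2 * N) 𝒢 d br)
    (hform : IsInvariantForm (-2 * N) 𝒢 d br form) {p q : ℤ} {u v : Current g}
    (hu : u ∈ currentDeg N 𝒢 p) (hv : v ∈ currentDeg N 𝒢 q) (w : Current g) (m n : ℕ) :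
    iterateSum br form u v w 0 m n =
      currentMode br form m u (currentMode br form n v w) -
        (-1 : ℂ) ^ (p * q) • currentMode br form n v (currentMode br form m u w) := by
  revert m n
  refine currentDeg_induction (P := fun p u => ∀ m n : ℕ, iterateSum br form u v w 0 m n =
      currentMode br form m u (currentMode br form n v w) -
        (-1 : ℂ) ^ (p * q) • currentMode br form n v (currentMode br form m u w)) ?_ ?_ ?_ ?_ hu
  · intro p c m n
    simp [iterateSum, currentMode_K_left]
  · intro p a ha
    refine currentDeg_induction (P := fun q v => ∀ m n : ℕ,
      iterateSum br form (currentOf 0 a) v w 0 m n =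
      currentMode br form m (currentOf 0 a) (currentMode br form n v w) - (-1 : ℂ) ^ (p * q) •
        currentMode br form n v (currentMode br form m (currentOf 0 a) w)) ?_ ?_ ?_ ?_ hv
    · intro q c m n
      simp [iterateSum, currentMode_K_left, currentMode_K_right]
    · intro q b hb m n
      rw [currentMode_generators_commutator hg hform ha hb, add_sub_cancel_right, iterateSum,
        Finset.sum_range_succ', Finset.sum_eq_zero, zero_add]
      · simp [currentMode_generators, generatorMode_zero]
      · intro i _
        rw [currentMode_generators]
        rcases i with _ | i
        · simp [generatorMode_one, currentMode_K_left]
        · rw [show 0 + (i + 1 + 1) = i + 2 by omega, generatorMode_add_two]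
          simp
    · intro q v h m n
      have e := neg_one_zpow_mul_shift p q 0 N
      rw [mul_zero, add_zero] at e
      rw [iterateSum_currentD_right, h, currentMode_currentD_left, currentMode_currentD_left, e,
        map_neg, map_smul, smul_neg, smul_sub, smul_comm (n : ℂ)]
      abel
    · intro q v v' h h' m n
      have e : iterateSum br form (currentOf 0 a) (v + v') w 0 m n =
          iterateSum br form (currentOf 0 a) v w 0 m n +
            iterateSum br form (currentOf 0 a) v' w 0 m n := by
        simp [iterateSum, Finset.sum_add_distrib]
      simp only [e, h, h', map_add, LinearMap.add_apply, smul_add]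
      abel
  · intro p u h m n
    have e := neg_one_zpow_mul_shift p q N 0
    rw [mul_zero, add_zero] at e
    rw [iterateSum_currentD_left, h, currentMode_currentD_left, currentMode_currentD_left, e,
      map_neg, map_smul, smul_neg, smul_sub, smul_comm (m : ℂ)]
    abel
  · intro p u u' h h' m n
    have e : iterateSum br form (u + u') v w 0 m n =
        iterateSum br form u v w 0 m n + iterateSum br form u' v w 0 m n := by
      simp [iterateSum, Finset.sum_add_distrib]
    simp only [e, h, h', map_add, LinearMap.add_apply, smul_add]
    abel

end CurrentVertex

/-! ### The half Jacobi identity -/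

section Alternating

variable {U : Type*} [AddCommGroup U] [Module ℂ U]

/-- The coefficient `∑_{i ≤ l} (-1)^i (l choose i) f (m+l-i) (n+i)` of `(x₁ - x₂)^l f(x₁, x₂)`. -/
def alternatingSum (f : ℕ → ℕ → U) (l m n : ℕ) : U :=
  ∑ i ∈ Finset.range (l + 1), ((-1 : ℂ) ^ i * l.choose i) • f (m + l - i) (n + i)

/-- Reading `f a b` as `x₁^a x₂^b`, the sum is `(x₁ - x₂)^l x₁^m x₂^n`, and one more factor `x₁ -
x₂` is expanded. The proof is Pascal's rule. -/
theorem alternatingSum_succ (f : ℕ → ℕ → U) (l m n : ℕ) :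
    alternatingSum f (l + 1) m n = alternatingSum f l (m + 1) n - alternatingSum f l m (n + 1) := by
  have h1 : alternatingSum f l (m + 1) n = (∑ i ∈ Finset.range (l + 1),
      ((-1 : ℂ) ^ (i + 1) * l.choose (i + 1)) • f (m + l - i) (n + 1 + i)) + f (m + (l + 1)) n := by
    -- The sum is padded by the vanishing binomial `l choose (l + 1)`, so that its first term can be
    -- split off and the rest matched by Pascal's rule.
    have e : alternatingSum f l (m + 1) n = ∑ i ∈ Finset.range (l + 2),
        ((-1 : ℂ) ^ i * l.choose i) • f (m + 1 + l - i) (n + i) := by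
      rw [Finset.sum_range_succ _ (l + 1), Nat.choose_succ_self]
      simp [alternatingSum]
    rw [e, Finset.sum_range_succ']
    congr 1
    · refine Finset.sum_congr rfl fun i _ => ?_
      rw [show m + 1 + l - (i + 1) = m + l - i by omega, show n + (i + 1) = n + 1 + i by omega]
    · simp [show m + 1 + l = m + (l + 1) by omega]
  rw [h1, alternatingSum, Finset.sum_range_succ', alternatingSum]
  simp only [pow_zero, Nat.choose_zero_right, Nat.cast_one, mul_one, one_smul, Nat.sub_zero,
    add_zero]
  rw [add_sub_right_comm, ← Finset.sum_sub_distrib]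
  congr 1
  refine Finset.sum_congr rfl fun i _ => ?_
  rw [show m + (l + 1) - (i + 1) = m + l - i by omega, show n + (i + 1) = n + 1 + i by omega,
    ← sub_smul, Nat.choose_succ_succ]
  congr 1
  push_cast
  ring

/-- The sum `∑_{i ≤ m} (m choose i) f (m+n-i) (l+i)`. -/
def binomialSum (f : ℕ → ℕ → U) (l m n : ℕ) : U :=
  ∑ i ∈ Finset.range (m + 1), (m.choose i : ℂ) • f (m + n - i) (l + i)

/-- Reading `f a b` as `x₂^a x₀^b`, the sum is `x₀^l (x₀ + x₂)^m x₂^n`, and the recursion is `x₀ =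
(x₀ + x₂) - x₂`. It matches that of `alternatingSum` under `x₁ = x₀ + x₂`. -/
theorem binomialSum_succ (f : ℕ → ℕ → U) (l m n : ℕ) :
    binomialSum f (l + 1) m n = binomialSum f l (m + 1) n - binomialSum f l m (n + 1) := by
  have h1 : binomialSum f l m (n + 1) = (∑ i ∈ Finset.range (m + 1),
      (m.choose (i + 1) : ℂ) • f (m + n - i) (l + 1 + i)) + f (m + 1 + n) l := by
    have e : binomialSum f l m (n + 1) = ∑ i ∈ Finset.range (m + 2),
        (m.choose i : ℂ) • f (m + (n + 1) - i) (l + i) := by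
      rw [Finset.sum_range_succ _ (m + 1), Nat.choose_succ_self]
      simp [binomialSum]
    rw [e, Finset.sum_range_succ']
    congr 1
    · refine Finset.sum_congr rfl fun i _ => ?_
      rw [show m + (n + 1) - (i + 1) = m + n - i by omega, show l + (i + 1) = l + 1 + i by omega]
    · simp [show m + (n + 1) = m + 1 + n by omega]
  rw [h1, binomialSum, binomialSum, Finset.sum_range_succ' _ (m + 1)]
  simp only [Nat.choose_zero_right, Nat.cast_one, one_smul, Nat.sub_zero, add_zero]
  rw [add_sub_add_right_eq_sub, ← Finset.sum_sub_distrib]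
  refine Finset.sum_congr rfl fun i _ => ?_
  rw [show m + 1 + n - (i + 1) = m + n - i by omega, show l + (i + 1) = l + 1 + i by omega,
    ← sub_smul, Nat.choose_succ_succ]
  congr 1
  push_cast
  ring

theorem Yminus_neg_sub_one (mode : ℕ → U →ₗ[ℂ] U →ₗ[ℂ] U) (u v : U) (n : ℕ) :
    Yminus mode u v (-(n : ℤ) - 1) = mode n u v := by
  rw [Yminus, if_pos (by omega), show (-(-(n : ℤ) - 1) - 1).toNat = n by omega]

theorem exists_eq_neg_natCast_sub_one {e : ℤ} (he : e < 0) : ∃ n : ℕ, e = -(n : ℤ) - 1 :=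
  ⟨(-e - 1).toNat, by omega⟩

/-- Upper negation for binomial coefficients. It makes the sum coming from the delta function stop
at `i = m`. -/
theorem neg_one_pow_mul_choose (m i : ℕ) :
    (-1 : ℤ) ^ i * Ring.choose (-(m : ℤ) - 1 + i) i = m.choose i := by
  have h := Ring.choose_neg ((m : ℤ) + 1 - i) i
  rw [show -((m : ℤ) + 1 - i) = -(m : ℤ) - 1 + i by ring,
    show (m : ℤ) + 1 - i + i - 1 = m by ring, Ring.choose_natCast] at h
  rw [h, Units.smul_def, smul_eq_mul, ← mul_assoc]
  rw [Int.negOnePow_def, zpow_natCast, Units.val_pow_eq_pow_val, Units.val_neg, Units.val_one,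
    ← mul_pow, neg_one_mul, neg_neg, one_pow, one_mul]

theorem jacobiIterate_eq_sum (mode : ℕ → U →ₗ[ℂ] U →ₗ[ℂ] U) (u v w : U) (l m n : ℕ) :
    jacobiIterate mode u v w (-(l : ℤ) - 1) (-(m : ℤ) - 1) (-(n : ℤ) - 1) =
      ∑ i ∈ Finset.range (m + 1), (m.choose i : ℂ) • mode (m + n - i) (mode (l + i) u v) w := by
  rw [jacobiIterate]
  simp only [neg_one_pow_mul_choose]
  rw [finsum_eq_sum_of_support_subset (s := Finset.range (m + 1))]
  · refine Finset.sum_congr rfl fun i hi => ?_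
    have hi := Finset.mem_range.1 hi
    rw [show -(l : ℤ) - 1 - i = -((l + i : ℕ) : ℤ) - 1 by push_cast; ring,
      show -(n : ℤ) - 1 + (-(m : ℤ) - 1 + i) + 1 = -((m + n - i : ℕ) : ℤ) - 1 by omega,
      Yminus_neg_sub_one, Yminus_neg_sub_one, natCast_zsmul, Nat.cast_smul_eq_nsmul]
  · intro i hi
    by_contra h
    refine hi ?_
    beta_reduce
    rw [Nat.choose_eq_zero_of_lt (by simpa using h)]
    simp

/-- The exponents are left unsimplified to match the unfolded product and opposite terms; the latter
is the same sum with `u, v` and `m, n` exchanged. -/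
theorem finsum_choose_Yminus_eq_alternatingSum (mode : ℕ → U →ₗ[ℂ] U →ₗ[ℂ] U) (u v w : U)
    (l m n : ℕ) :
    ∑ᶠ i : ℕ, ((-1 : ℤ) ^ i * Ring.choose (-(-(l : ℤ) - 1) - 1) i) •
      Yminus mode u (Yminus mode v w (-(n : ℤ) - 1 - i))
        (-(m : ℤ) - 1 - (-(-(l : ℤ) - 1) - 1) + i) =
      alternatingSum (fun x y => mode x u (mode y v w)) l m n := by
  rw [show -(-(l : ℤ) - 1) - 1 = l by ring]
  simp only [Ring.choose_natCast]
  rw [finsum_eq_sum_of_support_subset (s := Finset.range (l + 1)), alternatingSum]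
  · refine Finset.sum_congr rfl fun i hi => ?_
    have hi := Finset.mem_range.1 hi
    rw [show -(n : ℤ) - 1 - i = -((n + i : ℕ) : ℤ) - 1 by push_cast; ring,
      show -(m : ℤ) - 1 - l + i = -((m + l - i : ℕ) : ℤ) - 1 by omega,
      Yminus_neg_sub_one, Yminus_neg_sub_one, ← Int.cast_smul_eq_zsmul ℂ]
    push_cast
    rfl
  · intro i hi
    by_contra h
    refine hi ?_
    beta_reduce
    rw [Nat.choose_eq_zero_of_lt (by simpa using h)]
    simp

end Alternating

/-! ### Borcherds' identity and the vertex Lie algebra structure on `U` -/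

section CurrentVertex

variable {g : Type*} [AddCommGroup g] [Module ℂ g] {N : ℤ} {𝒢 : ℤ → Submodule ℂ g}
  {d : g →ₗ[ℂ] g} {br : g →ₗ[ℂ] g →ₗ[ℂ] g} {form : g →ₗ[ℂ] g →ₗ[ℂ] ℂ}

theorem iterateSum_succ (u v w : Current g) (l m n : ℕ) :
    iterateSum br form u v w (l + 1) m n =
      iterateSum br form u v w l (m + 1) n - iterateSum br form u v w l m (n + 1) :=
  binomialSum_succ (fun x y => currentMode br form x (currentMode br form y u v) w) l m n

/-- Induction on `l` from the commutator formula. In the opposite term `m` and `n` are exchanged, so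
the common recursion appears there negated, which accounts for `(-1)^l`. -/
theorem currentMode_borcherds (hg : IsDGLieAlgebra (-2 * N) 𝒢 d br)
    (hform : IsInvariantForm (-2 * N) 𝒢 d br form) {p q : ℤ} {u v : Current g}
    (hu : u ∈ currentDeg N 𝒢 p) (hv : v ∈ currentDeg N 𝒢 q) (w : Current g) (l m n : ℕ) :
    iterateSum br form u v w l m n =
      alternatingSum (fun x y => currentMode br form x u (currentMode br form y v w)) l m n -
        (-1 : ℂ) ^ (p * q) • (-1 : ℂ) ^ l •
          alternatingSum (fun x y => currentMode br form x v (currentMode br form y u w)) l n m := by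
  induction l generalizing m n with
  | zero =>
    rw [currentMode_commutator hg hform hu hv]
    simp [alternatingSum]
  | succ l ih =>
    rw [iterateSum_succ, ih, ih, alternatingSum_succ, alternatingSum_succ, pow_succ]
    module

/-- `ℂ[D] ⊗ g ⊕ ℂK` is a dg vertex Lie algebra. -/
theorem isDGVertexLieAlgebra_current (hg : IsDGLieAlgebra (-2 * N) 𝒢 d br)
    (hform : IsInvariantForm (-2 * N) 𝒢 d br form) :
    IsDGVertexLieAlgebra N (currentDeg N 𝒢) (currentDiff d) (currentMode br form) currentD where
  toIsCochainComplex := currentDeg_isCochainComplex hg.toIsCochainComplex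
  mode_mem n p q u v hu hv := currentMode_mem hg hform hu hv n
  d_mode n p u v hu := by
    rw [currentDiff_currentMode hg hform hu,
      show p - 2 * N * ((n : ℤ) + 1) = p + 2 * (-(N * (n + 1))) by ring, neg_one_zpow_add_shift]
  D_mem p u hu := currentD_mem hu
  D_d := currentD_currentDiff
  truncation := currentMode_truncation
  D_comm u v e := by
    rcases lt_or_ge e 0 with he | he
    · obtain ⟨n, rfl⟩ := exists_eq_neg_natCast_sub_one he
      simp only [Yminus_neg_sub_one, currentMode_currentD_left, currentMode_currentD_right]
      abel
    · simp [Yminus, not_lt.2 he]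
  D_deriv u v e := by
    rcases lt_or_ge e 0 with he | he
    · obtain ⟨n, rfl⟩ := exists_eq_neg_natCast_sub_one he
      rw [Yminus_neg_sub_one, currentMode_currentD_left]
      rcases n with _ | n
      · simp
      · rw [show -((n + 1 : ℕ) : ℤ) - 1 + 1 = -((n : ℕ) : ℤ) - 1 by push_cast; ring,
          Yminus_neg_sub_one, Nat.add_sub_cancel, ← Int.cast_smul_eq_zsmul ℂ, ← neg_smul]
        congr 1
        push_cast
        ring
    · simp [Yminus, not_lt.2 he, not_lt.2 (show 0 ≤ e + 1 by omega)]
  half_skew p q u v hu hv e he := by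
    obtain ⟨n, rfl⟩ := exists_eq_neg_natCast_sub_one he
    obtain ⟨M₀, hM₀⟩ := currentMode_skew hg hform hu hv
    obtain ⟨M₁, hM₁⟩ := currentMode_truncation (br := br) (form := form) v u
    have hY : ∀ k : ℕ, Yminus (currentMode br form) v u (-(n : ℤ) - 1 - k) =
        currentMode br form (n + k) v u := by
      intro k
      rw [show -(n : ℤ) - 1 - k = -((n + k : ℕ) : ℤ) - 1 by push_cast; ring, Yminus_neg_sub_one]
    simp only [hY]
    -- `M₀` makes skew symmetry hold with finite sums; `M₁` ensures that the terms omitted from the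
    -- infinite sum are zero.
    rw [Yminus_neg_sub_one, hM₀ (max M₀ M₁) (by omega),
      finsum_eq_sum_of_support_subset (s := Finset.range (max M₀ M₁)), skewSum, ← smul_neg,
      ← Finset.sum_neg_distrib]
    · congr 1
      refine Finset.sum_congr rfl fun k _ => ?_
      have e : (-1 : ℂ) ^ (-(n : ℤ) - 1 - k) = -(-1 : ℂ) ^ (n + k) := by
        rw [← zpow_natCast, ← neg_one_mul ((-1 : ℂ) ^ ((n + k : ℕ) : ℤ)),
          ← zpow_one_add₀ (by norm_num)]
        refine neg_one_zpow_congr ⟨-(n + k + 1 : ℤ), ?_⟩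
        push_cast
        ring
      rw [map_smul, e, smul_smul, ← neg_smul]
      congr 1
      ring
    · intro k hk
      by_contra h
      refine hk ?_
      have : max M₀ M₁ ≤ k := by simpa using h
      simp [hM₁ (n + k) (by omega)]
  half_jacobi p q u v w hu hv e₀ e₁ e₂ h₀ h₁ h₂ := by
    obtain ⟨l, rfl⟩ := exists_eq_neg_natCast_sub_one h₀
    obtain ⟨m, rfl⟩ := exists_eq_neg_natCast_sub_one h₁
    obtain ⟨n, rfl⟩ := exists_eq_neg_natCast_sub_one h₂
    rw [jacobiIterate_eq_sum, jacobiProduct, jacobiOpposite,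
      finsum_choose_Yminus_eq_alternatingSum, finsum_choose_Yminus_eq_alternatingSum,
      show -(-(l : ℤ) - 1) - 1 = l by ring, zpow_natCast]
    exact currentMode_borcherds hg hform hu hv w l m n

end CurrentVertex

/-! ### The affine dg Lie algebra -/

section Affine

variable {g : Type*} [AddCommGroup g] [Module ℂ g] {N : ℤ} {𝒢 : ℤ → Submodule ℂ g}
  {d : g →ₗ[ℂ] g} {br : g →ₗ[ℂ] g →ₗ[ℂ] g} {form : g →ₗ[ℂ] g →ₗ[ℂ] ℂ}

theorem affine_eq_add (f : ℤ →₀ g) (c : ℂ) :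
    ((f, c) : Affine g) = (f, 0) + c • affineK := by simp [affineK]

theorem Affine.induction_affineOf {P : Affine g → Prop} (hK : ∀ c : ℂ, P (c • affineK))
    (hof : ∀ n a, P (affineOf n a)) (hadd : ∀ x y, P x → P y → P (x + y)) (x : Affine g) :
    P x := by
  obtain ⟨f, c⟩ := x
  rw [affine_eq_add]
  refine hadd _ _ ?_ (hK c)
  induction f using Finsupp.induction_linear with
  | zero =>
    have h0 := hK 0
    rwa [zero_smul] at h0
  | add f f' hf hf' => simpa using hadd _ _ hf hf'
  | single n a => exact hof n a

theorem affineOf_add (n : ℤ) (a b : g) : affineOf n (a + b) = affineOf n a + affineOf n b := by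
  simp [affineOf]

theorem affineOf_smul (n : ℤ) (c : ℂ) (a : g) : affineOf n (c • a) = c • affineOf n a := by
  simp [affineOf]

theorem affineOf_neg (n : ℤ) (a : g) : affineOf n (-a) = -affineOf n a := by
  simp [affineOf]

theorem affineOf_mem {p n : ℤ} {a : g} (ha : a ∈ 𝒢 (p + 2 * N * n)) :
    affineOf n a ∈ affineDeg N 𝒢 p := by
  refine ⟨fun j => ?_, by simp [affineOf]⟩
  simp only [affineOf, Finsupp.single_apply]
  split_ifs with h
  · exact h ▸ ha
  · exact zero_mem _

theorem smul_affineK_mem {p : ℤ} {c : ℂ} (h : p = 2 * N ∨ c = 0) :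
    c • (affineK : Affine g) ∈ affineDeg N 𝒢 p := by
  rcases h with rfl | rfl
  · exact ⟨fun j => by simp [affineK], by simp⟩
  · simp

-- Here the degree stays fixed, and the scalar of `K` is known to vanish outside degree `2N`.
@[elab_as_elim]
theorem affineDeg_induction {P : Affine g → Prop} {p : ℤ}
    (hK : ∀ c : ℂ, p = 2 * N ∨ c = 0 → P (c • affineK))
    (hof : ∀ (n : ℤ), ∀ a ∈ 𝒢 (p + 2 * N * n), P (affineOf n a))
    (hadd : ∀ x y, P x → P y → P (x + y)) {x : Affine g} (hx : x ∈ affineDeg N 𝒢 p) : P x := by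
  obtain ⟨f, c⟩ := x
  rw [affine_eq_add]
  refine hadd _ _ ?_ (hK c ?_)
  · have hf : ∀ n : ℤ, f n ∈ 𝒢 (p + 2 * N * n) := hx.1
    have e : ((f, 0) : Affine g) = ∑ n ∈ f.support, affineOf n (f n) := by
      conv_lhs => rw [← Finsupp.sum_single f]
      exact map_sum (LinearMap.inl ℂ (ℤ →₀ g) ℂ) _ _
    rw [e]
    refine Finset.sum_induction _ P hadd ?_ fun n _ => hof n _ (hf n)
    have h0 := hK 0 (Or.inr rfl)
    rwa [zero_smul] at h0
  · have hc := hx.2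
    by_cases h : p = 2 * N
    · exact Or.inl h
    · rw [if_neg h] at hc
      exact Or.inr hc

theorem affineD_affineOf (n : ℤ) (a : g) : affineD d (affineOf n a) = affineOf n (d a) := by
  simp [affineD, affineOf, loopD]

theorem affineD_affineK : affineD d (affineK : Affine g) = 0 := by
  simp [affineD, affineK]

theorem affineBracket_affineK_left (x : Affine g) : affineBracket br form affineK x = 0 := by
  simp [affineBracket, affineK]

theorem affineBracket_affineK_right (x : Affine g) : affineBracket br form x affineK = 0 := by
  simp [affineBracket, affineK]

theorem affineBracket_affineOf (m n : ℤ) (a b : g) :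
    affineBracket br form (affineOf m a) (affineOf n b) =
      affineOf (m + n) (br a b) + ((if m + n = 0 then (m : ℂ) else 0) * form a b) • affineK := by
  by_cases h : m + n = 0 <;> simp [affineBracket, affineOf, affineK, h]

theorem affineDeg_isCochainComplex (hg : IsCochainComplex 𝒢 d) :
    IsCochainComplex (affineDeg N 𝒢) (affineD d) where
  isInternal := isInternal_prod
    (isInternal_finsupp hg.isInternal (fun n : ℤ => 2 * N * n) _ fun _ _ => Iff.rfl)
    (isInternal_concentrated (2 * N))
  d_mem p v hv := by
    refine ⟨fun k => ?_, by simp [affineD]⟩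
    have := hg.d_mem _ _ (hv.1 k)
    rw [show p + 2 * N * k + 1 = p + 1 + 2 * N * k by ring] at this
    simpa [affineD, loopD] using this
  d_d v := by
    ext
    · simp [affineD, loopD, hg.d_d]
    · simp [affineD]

/-- As `|t|` is even, the loop component of each axiom is the same axiom in `g`. The `K`-components
are, in turn, the degree condition, `d`-compatibility, symmetry and invariance of the form. -/
theorem isDGLieAlgebra_affine (hg : IsDGLieAlgebra (-2 * N) 𝒢 d br)
    (hform : IsInvariantForm (-2 * N) 𝒢 d br form) :
    IsDGLieAlgebra (-2 * N) (affineDeg N 𝒢) (affineD d) (affineBracket br form) where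
  toIsCochainComplex := affineDeg_isCochainComplex hg.toIsCochainComplex
  br_mem m n x y hx hy := by
    refine affineDeg_induction (fun c _ => ?_) (fun i a ha => ?_) (fun x x' h h' => ?_) hx
    · simp [affineBracket_affineK_left]
    · refine affineDeg_induction (fun c _ => ?_) (fun j b hb => ?_) (fun y y' h h' => ?_) hy
      · simp [affineBracket_affineK_right]
      · rw [affineBracket_affineOf]
        refine add_mem (affineOf_mem ?_) (smul_affineK_mem ?_)
        · convert hg.br_mem _ _ a b ha hb using 2
          ring
        · by_cases h : i + j = 0
          · by_cases h' : m + 2 * N * i + (n + 2 * N * j) = 4 * N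
            · left
              linear_combination h' - 2 * N * h
            · right
              rw [hform.form_eq_zero ha hb h', mul_zero]
          · simp [h]
      · rw [map_add]
        exact add_mem h h'
    · rw [map_add, LinearMap.add_apply]
      exact add_mem h h'
  d_br m x y hx := by
    rw [show m + -2 * N = m + 2 * -N by ring, neg_one_zpow_add_shift]
    refine affineDeg_induction (fun c _ => ?_) (fun i a ha => ?_) (fun x x' h h' => ?_) hx
    · simp [affineBracket_affineK_left, affineD_affineK]
    · induction y using Affine.induction_affineOf with
      | hK c => simp [affineBracket_affineK_right, affineD_affineK]
      | hadd y y' h h' =>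
        simp only [map_add, h, h', smul_add]
        abel
      | hof j b =>
        have e : (-1 : ℂ) ^ (m + 2 * N * i) = (-1 : ℂ) ^ m := by
          rw [mul_assoc, neg_one_zpow_add_shift]
        have hd := hform.d_form_even ha b
        rw [e] at hd
        simp only [affineBracket_affineOf, map_add, map_smul, affineD_affineOf, affineD_affineK,
          hg.d_br_even ha, e, affineOf_add, affineOf_smul, smul_zero, add_zero, smul_add]
        rw [eq_neg_of_add_eq_zero_left hd]
        module
    · simp only [map_add, LinearMap.add_apply, h, h', smul_add]
      abel
  antisymm m n x y hx hy := by
    rw [show -2 * N = 2 * -N by ring, neg_one_zpow_mul_shift]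
    refine affineDeg_induction (fun c _ => ?_) (fun i a ha => ?_) (fun x x' h h' => ?_) hx
    · simp [affineBracket_affineK_left, affineBracket_affineK_right]
    · refine affineDeg_induction (fun c _ => ?_) (fun j b hb => ?_) (fun y y' h h' => ?_) hy
      · simp [affineBracket_affineK_left, affineBracket_affineK_right]
      · have e : (-1 : ℂ) ^ ((m + 2 * N * i) * (n + 2 * N * j)) = (-1 : ℂ) ^ (m * n) := by
          rw [mul_assoc, mul_assoc, neg_one_zpow_mul_shift]
        rw [affineBracket_affineOf, affineBracket_affineOf, hg.antisymm_even ha hb,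
          hform.symm_even ha hb, e, affineOf_neg, affineOf_smul, add_comm j i]
        by_cases h : i + j = 0
        · obtain rfl : j = -i := by omega
          simp only [h, if_true]
          push_cast
          module
        · simp [h]
      · simp only [map_add, LinearMap.add_apply, h, h', smul_add, neg_add]
    · simp only [map_add, LinearMap.add_apply, h, h', smul_add, neg_add]
  jacobi m n x y z hx hy := by
    rw [show -2 * N = 2 * -N by ring, neg_one_zpow_mul_shift]
    refine affineDeg_induction (fun c _ => ?_) (fun i a ha => ?_) (fun x x' h h' => ?_) hx
    · simp [affineBracket_affineK_left]
    · refine affineDeg_induction (fun c _ => ?_) (fun j b hb => ?_) (fun y y' h h' => ?_) hy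
      · simp [affineBracket_affineK_left, affineBracket_affineK_right]
      · induction z using Affine.induction_affineOf with
        | hK c => simp [affineBracket_affineK_right]
        | hadd z z' h h' =>
          simp only [map_add, h, h', smul_add]
          abel
        | hof k c =>
          have e : (-1 : ℂ) ^ ((m + 2 * N * i) * (n + 2 * N * j)) = (-1 : ℂ) ^ (m * n) := by
            rw [mul_assoc, mul_assoc, neg_one_zpow_mul_shift]
          have hs := hform.form_br_swap hg ha hb c
          rw [e] at hs
          simp only [affineBracket_affineOf, map_add, LinearMap.add_apply, map_smul,
            LinearMap.smul_apply, affineBracket_affineK_left, affineBracket_affineK_right,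
            smul_zero, add_zero, hg.jacobi_even ha hb, e, affineOf_add, affineOf_smul, smul_add]
          -- All `K`-coefficients become multiples of `⟨[a, b], c⟩`; the identity left is `i = (i +
          -- j) - j`, on `i + j + k = 0`.
          rw [← hform.invariant, smul_smul, mul_left_comm, hs, add_assoc i j k,
            add_left_comm j i k]
          by_cases h : i + (j + k) = 0
          · simp only [h, if_true]
            push_cast
            module
          · simp [h]
      · simp only [map_add, LinearMap.add_apply, h, h', smul_add]
        abel
    · simp only [map_add, LinearMap.add_apply, h, h', smul_add]
      abel

end Affine

/-! ### Transport of structure -/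

theorem IsDGLieIso.isDGLieAlgebra {V W : Type*} [AddCommGroup V] [Module ℂ V] [AddCommGroup W]
    [Module ℂ W] {𝒱 : ℤ → Submodule ℂ V} {dV : V →ₗ[ℂ] V} {brV : V →ₗ[ℂ] V →ₗ[ℂ] V}
    {𝒲 : ℤ → Submodule ℂ W} {dW : W →ₗ[ℂ] W} {brW : W →ₗ[ℂ] W →ₗ[ℂ] W} {φ : V ≃ₗ[ℂ] W} {q : ℤ}
    (hφ : IsDGLieIso 𝒱 dV brV 𝒲 dW brW φ) (hW : IsDGLieAlgebra q 𝒲 dW brW) :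
    IsDGLieAlgebra q 𝒱 dV brV where
  isInternal := isInternal_of_linearEquiv φ hW.isInternal hφ.mem_iff
  d_mem p v hv := by
    rw [← hφ.mem_iff] at hv ⊢
    rw [hφ.map_d]
    exact hW.d_mem p _ hv
  d_d v := φ.injective (by rw [hφ.map_d, hφ.map_d, hW.d_d, map_zero])
  br_mem m n a b ha hb := by
    rw [← hφ.mem_iff] at ha hb ⊢
    rw [hφ.map_br]
    exact hW.br_mem m n _ _ ha hb
  d_br m a b ha := φ.injective (by
    rw [← hφ.mem_iff] at ha
    simp only [hφ.map_d, hφ.map_br, map_add, map_smul]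
    exact hW.d_br m _ _ ha)
  antisymm m n a b ha hb := φ.injective (by
    rw [← hφ.mem_iff] at ha hb
    simp only [hφ.map_br, map_neg, map_smul]
    exact hW.antisymm m n _ _ ha hb)
  jacobi m n a b c ha hb := φ.injective (by
    rw [← hφ.mem_iff] at ha hb
    simp only [hφ.map_br, map_add, map_smul]
    exact hW.jacobi m n _ _ _ ha hb)

/-! ### The isomorphism `𝓛(U) ≃ ĝ` -/

section Iso

variable {g : Type*} [AddCommGroup g] [Module ℂ g] {N : ℤ} {𝒢 : ℤ → Submodule ℂ g}
  {d : g →ₗ[ℂ] g} {br : g →ₗ[ℂ] g →ₗ[ℂ] g} {form : g →ₗ[ℂ] g →ₗ[ℂ] ℂ}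

/-- The scalar `(-1)^k n (n - 1) ⋯ (n - k + 1)` with `(D^k a)_n = (-1)^k n ⋯ (n - k + 1) a_(n-k)`. -/
def modeCoeff : ℤ → ℕ → ℂ
  | _, 0 => 1
  | n, k + 1 => -n * modeCoeff (n - 1) k

/-- The linear map `u ↦ u_n`, with values in `ĝ`. -/
def currentToAffine (n : ℤ) : Current g →ₗ[ℂ] Affine g :=
  LinearMap.coprod
    (Finsupp.lsum ℂ fun k : ℕ => modeCoeff n k •
      (LinearMap.inl ℂ (ℤ →₀ g) ℂ).comp (Finsupp.lsingle (n - k)))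
    -- The relation `D K ⊗ t^(n+1) + (n + 1) K ⊗ t^n = 0` leaves only `K_(-1)`.
    ((if n = -1 then (1 : ℂ) else 0) • LinearMap.inr ℂ (ℤ →₀ g) ℂ)

theorem currentToAffine_currentOf (n : ℤ) (k : ℕ) (a : g) :
    currentToAffine n (currentOf k a) = modeCoeff n k • affineOf (n - k) a := by
  simp [currentToAffine, currentOf, affineOf]

theorem currentToAffine_currentK (n : ℤ) :
    currentToAffine n (currentK : Current g) = (if n = -1 then (1 : ℂ) else 0) • affineK := by
  by_cases h : n = -1 <;> simp [currentToAffine, currentK, affineK, h]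

/-- This is the relation defining `𝓛(U)`, so the map descends to the quotient. For `K` both sides
vanish: `K_(n-1)` is nonzero only at `n = 0`, where the factor `n` is zero. -/
theorem currentToAffine_currentD (n : ℤ) (u : Current g) :
    currentToAffine n (currentD u) = -((n : ℂ) • currentToAffine (n - 1) u) := by
  induction u using Current.induction_currentOf with
  | hK c =>
    rw [map_smul, map_smul, map_smul, currentD_currentK, currentToAffine_currentK]
    by_cases h : n = 0
    · simp [h]
    · simp [show ¬ n - 1 = -1 by omega]
  | hadd u v hu hv => simp only [map_add, hu, hv, smul_add, neg_add]
  | hof k a =>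
    rw [currentD_currentOf, currentToAffine_currentOf, currentToAffine_currentOf, modeCoeff,
      smul_smul, ← neg_smul, neg_mul]
    congr 2
    push_cast
    ring

/-- The linear map `𝓛(U) → ĝ`. -/
def modeLieToAffine : ModeLie (currentD : Current g →ₗ[ℂ] Current g) →ₗ[ℂ] Affine g :=
  Submodule.liftQ _ (Finsupp.lsum ℂ currentToAffine) <| by
    rintro _ ⟨f, rfl⟩
    rw [LinearMap.mem_ker]
    induction f using Finsupp.induction_linear with
    | zero => simp
    | add f f' hf hf' => rw [map_add, map_add, hf, hf', add_zero]
    | single n u =>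
      rw [Dhat_single, map_add, map_smul]
      simp [currentToAffine_currentD]

theorem modeLieToAffine_modeOf (n : ℤ) (u : Current g) :
    modeLieToAffine (modeOf currentD n u) = currentToAffine n u := by
  simp [modeLieToAffine, modeOf]

/-- The linear map `ĝ → 𝓛(U)`. -/
def affineToModeLie : Affine g →ₗ[ℂ] ModeLie (currentD : Current g →ₗ[ℂ] Current g) :=
  LinearMap.coprod
    (Finsupp.lsum ℂ fun n : ℤ => (modeOf (currentD : Current g →ₗ[ℂ] Current g) n).comp (currentOf 0))
    (LinearMap.toSpanSingleton ℂ _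
      (modeOf (currentD : Current g →ₗ[ℂ] Current g) (-1) currentK))

theorem affineToModeLie_affineOf (n : ℤ) (a : g) :
    affineToModeLie (affineOf n a) = modeOf currentD n (currentOf 0 a) := by
  simp [affineToModeLie, affineOf]

theorem affineToModeLie_affineK :
    affineToModeLie (affineK : Affine g) =
      modeOf currentD (-1) (currentK : Current g) := by
  simp [affineToModeLie, affineK]

theorem modeOf_D {U : Type*} [AddCommGroup U] [Module ℂ U] (D : U →ₗ[ℂ] U) (n : ℤ) (u : U) :
    modeOf D n (D u) = -((n : ℂ) • modeOf D (n - 1) u) := by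
  rw [eq_neg_iff_add_eq_zero]
  have h : (LinearMap.range (Dhat D)).mkQ (Dhat D (Finsupp.single n u)) = 0 := by
    rw [Submodule.mkQ_apply, Submodule.Quotient.mk_eq_zero]
    exact ⟨_, rfl⟩
  rwa [Dhat_single, map_add, map_smul] at h

theorem modeOf_currentK {n : ℤ} (hn : n ≠ -1) :
    modeOf currentD n (currentK : Current g) = 0 := by
  have h := modeOf_D currentD (n + 1) (currentK : Current g)
  rw [currentD_currentK, map_zero, zero_eq_neg, add_sub_cancel_right, smul_eq_zero] at h
  refine h.resolve_left ?_
  exact_mod_cast fun h' => hn (by omega)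

/-- Both sides obey the same rule under `u ↦ D u`, so it suffices to compare them on generators and
`K`. -/
theorem affineToModeLie_currentToAffine (n : ℤ) (u : Current g) :
    affineToModeLie (currentToAffine n u) = modeOf currentD n u := by
  induction u using Current.induction_currentD generalizing n with
  | hK c =>
    rw [map_smul, map_smul, map_smul, currentToAffine_currentK, map_smul, affineToModeLie_affineK]
    by_cases h : n = -1
    · simp [h]
    · simp [h, modeOf_currentK h]
  | hadd u v hu hv => simp only [map_add, hu, hv]
  | hD u hu => rw [currentToAffine_currentD, map_neg, map_smul, hu, modeOf_D]
  | hgen a => simp [currentToAffine_currentOf, modeCoeff, affineToModeLie_affineOf]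

theorem ModeLie.induction_modeOf {U : Type*} [AddCommGroup U] [Module ℂ U] {D : U →ₗ[ℂ] U}
    {P : ModeLie D → Prop} (hof : ∀ n u, P (modeOf D n u)) (hadd : ∀ x y, P x → P y → P (x + y))
    (x : ModeLie D) : P x := by
  obtain ⟨f, rfl⟩ := Submodule.mkQ_surjective _ x
  induction f using Finsupp.induction_linear with
  | zero => simpa using hof 0 0
  | add f f' hf hf' => simpa using hadd _ _ hf hf'
  | single n u => exact hof n u

/-- The linear isomorphism `𝓛(U) ≃ ĝ` with `a_n ↦ a ⊗ t ^ n` and `K_(-1) ↦ K`. -/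
def modeLieEquivAffine : ModeLie (currentD : Current g →ₗ[ℂ] Current g) ≃ₗ[ℂ] Affine g where
  __ := modeLieToAffine
  invFun := affineToModeLie
  left_inv x := by
    change affineToModeLie (modeLieToAffine x) = x
    induction x using ModeLie.induction_modeOf with
    | hof n u => rw [modeLieToAffine_modeOf, affineToModeLie_currentToAffine]
    | hadd x y hx hy => simp only [map_add, hx, hy]
  right_inv x := by
    change modeLieToAffine (affineToModeLie x) = x
    induction x using Affine.induction_affineOf with
    | hK c =>
      rw [map_smul, map_smul, affineToModeLie_affineK, modeLieToAffine_modeOf,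
        currentToAffine_currentK, if_pos rfl, one_smul]
    | hof n a =>
      simp [affineToModeLie_affineOf, modeLieToAffine_modeOf, currentToAffine_currentOf, modeCoeff]
    | hadd x y hx hy => simp only [map_add, hx, hy]

theorem modeLieEquivAffine_modeOf (n : ℤ) (u : Current g) :
    modeLieEquivAffine (modeOf currentD n u) = currentToAffine n u :=
  modeLieToAffine_modeOf n u

theorem modeLieEquivAffine_generator (n : ℤ) (a : g) :
    modeLieEquivAffine (modeOf currentD n (currentOf 0 a)) = affineOf n a := by
  simp [modeLieEquivAffine_modeOf, currentToAffine_currentOf, modeCoeff]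

theorem modeLieEquivAffine_currentK (n : ℤ) :
    modeLieEquivAffine (modeOf currentD n (currentK : Current g)) =
      (if n = -1 then (1 : ℂ) else 0) • affineK := by
  rw [modeLieEquivAffine_modeOf, currentToAffine_currentK]

theorem modeOf_mem {U : Type*} [AddCommGroup U] [Module ℂ U] {D : U →ₗ[ℂ] U}
    {𝒰 : ℤ → Submodule ℂ U} {p n : ℤ} {u : U} (hu : u ∈ 𝒰 (p + 2 * N * n)) :
    modeOf D n u ∈ modeLieDeg N 𝒰 D p := by
  refine ⟨Finsupp.single n u, fun j => ?_, rfl⟩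
  rw [Finsupp.single_apply]
  split_ifs with h
  · exact h ▸ hu
  · exact zero_mem _

theorem currentToAffine_mem {p n : ℤ} {u : Current g} (hu : u ∈ currentDeg N 𝒢 (p + 2 * N * n)) :
    currentToAffine n u ∈ affineDeg N 𝒢 p := by
  obtain ⟨f, c⟩ := u
  have hf : ∀ k : ℕ, f k ∈ 𝒢 (p + 2 * N * n - 2 * N * k) := hu.1
  have e : ((f, c) : Current g) = (∑ k ∈ f.support, currentOf k (f k)) + c • currentK := by
    have e' : ((f, 0) : Current g) = ∑ k ∈ f.support, currentOf k (f k) := by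
      conv_lhs => rw [← Finsupp.sum_single f]
      exact map_sum (LinearMap.inl ℂ (ℕ →₀ g) ℂ) _ _
    rw [← e']
    simp [currentK]
  rw [e, map_add, map_sum, map_smul, currentToAffine_currentK, smul_smul]
  refine add_mem (sum_mem fun k _ => ?_) (smul_affineK_mem ?_)
  · rw [currentToAffine_currentOf]
    refine Submodule.smul_mem _ _ (affineOf_mem ?_)
    convert hf k using 2
    ring
  · have hc := hu.2
    by_cases hn : n = -1
    · by_cases h : p + 2 * N * n = 0
      · left
        subst hn
        linear_combination h
      · rw [if_neg h] at hc
        have hc : c = 0 := hc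
        simp [hc]
    · simp [hn]

theorem modeLieBracket_currentK_left
    (hU : IsDGVertexLieAlgebra N (currentDeg N 𝒢) (currentDiff d) (currentMode br form) currentD)
    (n : ℤ) (y : ModeLie (currentD : Current g →ₗ[ℂ] Current g)) :
    hU.modeLieBracket (modeOf currentD n currentK) y = 0 := by
  induction y using ModeLie.induction_modeOf with
  | hof p v => simp [hU.modeLieBracket_modeOf, currentMode_K_left]
  | hadd x y hx hy => rw [map_add, hx, hy, add_zero]

theorem modeLieBracket_currentK_right
    (hU : IsDGVertexLieAlgebra N (currentDeg N 𝒢) (currentDiff d) (currentMode br form) currentD)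
    (n : ℤ) (x : ModeLie (currentD : Current g →ₗ[ℂ] Current g)) :
    hU.modeLieBracket x (modeOf currentD n currentK) = 0 := by
  induction x using ModeLie.induction_modeOf with
  | hof p v => simp [hU.modeLieBracket_modeOf, currentMode_K_right]
  | hadd x y hx hy => rw [map_add, LinearMap.add_apply, hx, hy, add_zero]

theorem modeLieBracket_generators
    (hU : IsDGVertexLieAlgebra N (currentDeg N 𝒢) (currentDiff d) (currentMode br form) currentD)
    (n p : ℤ) (a b : g) :
    hU.modeLieBracket (modeOf currentD n (currentOf 0 a)) (modeOf currentD p (currentOf 0 b)) =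
      modeOf currentD (n + p) (currentOf 0 (br a b)) +
        ((n : ℂ) * form a b) • modeOf currentD (n + p - 1) (currentK : Current g) := by
  rw [hU.modeLieBracket_modeOf, finsum_eq_sum_of_support_subset (s := Finset.range 2)]
  · rw [Finset.sum_range_succ, Finset.sum_range_one, currentMode_generators,
      currentMode_generators, generatorMode_zero, generatorMode_one, Ring.choose_zero_right,
      Ring.choose_one_right, one_smul, map_smul, ← Int.cast_smul_eq_zsmul ℂ, smul_smul]
    simp
  · intro i hi
    by_contra h
    refine hi ?_
    obtain ⟨i, rfl⟩ := Nat.exists_eq_add_of_le' (show 2 ≤ i by simpa [Nat.succ_le_iff] using h)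
    beta_reduce
    rw [currentMode_generators, generatorMode_add_two, map_zero, smul_zero]

/-- Brackets are compared from the side of `ĝ`, where only `a ⊗ t^n` and `K` occur and no mode of
`D^k a` has to be expanded. -/
theorem modeLieBracket_affineToModeLie
    (hU : IsDGVertexLieAlgebra N (currentDeg N 𝒢) (currentDiff d) (currentMode br form) currentD)
    (x y : Affine g) :
    hU.modeLieBracket (affineToModeLie x) (affineToModeLie y) =
      affineToModeLie (affineBracket br form x y) := by
  induction x using Affine.induction_affineOf with
  | hK c =>
    simp only [map_smul, LinearMap.smul_apply, affineToModeLie_affineK,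
      modeLieBracket_currentK_left, affineBracket_affineK_left, smul_zero, map_zero]
  | hadd x x' h h' => simp only [map_add, LinearMap.add_apply, h, h']
  | hof m a =>
    induction y using Affine.induction_affineOf with
    | hK c =>
      simp only [map_smul, affineToModeLie_affineK, modeLieBracket_currentK_right,
        affineBracket_affineK_right, smul_zero, map_zero]
    | hadd y y' h h' => simp only [map_add, h, h']
    | hof n b =>
      rw [affineToModeLie_affineOf, affineToModeLie_affineOf, modeLieBracket_generators,
        affineBracket_affineOf, map_add, map_smul, affineToModeLie_affineOf,
        affineToModeLie_affineK]
      by_cases h : m + n = 0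
      · rw [if_pos h, h, zero_sub]
      · rw [if_neg h, modeOf_currentK (show m + n - 1 ≠ -1 by omega), zero_mul, zero_smul,
          smul_zero]

theorem isDGLieIso_modeLieEquivAffine
    (hU : IsDGVertexLieAlgebra N (currentDeg N 𝒢) (currentDiff d) (currentMode br form) currentD) :
    IsDGLieIso (modeLieDeg N (currentDeg N 𝒢) currentD) hU.modeLieD hU.modeLieBracket
      (affineDeg N 𝒢) (affineD d) (affineBracket br form) modeLieEquivAffine where
  mem_iff p x := by
    constructor
    · intro hx
      -- Membership in a graded piece of the quotient requires a homogeneous representative; the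
      -- inverse map provides one on spanning elements.
      rw [← modeLieEquivAffine.symm_apply_apply x]
      refine affineDeg_induction (P := fun y => modeLieEquivAffine.symm y ∈ _) (fun c hc => ?_)
        (fun n a ha => ?_) (fun y y' h h' => ?_) hx
      · change affineToModeLie (c • affineK) ∈ _
        rw [map_smul, affineToModeLie_affineK, ← (modeOf _ _).map_smul]
        refine modeOf_mem (smul_currentK_mem (hc.imp_left fun h => ?_))
        rw [h]
        ring
      · change affineToModeLie (affineOf n a) ∈ _
        rw [affineToModeLie_affineOf]
        exact modeOf_mem (currentOf_mem (by simpa using ha))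
      · rw [map_add]
        exact add_mem h h'
    · rintro ⟨f, hf, rfl⟩
      have hf : ∀ n : ℤ, f n ∈ currentDeg N 𝒢 (p + 2 * N * n) := hf
      change Finsupp.lsum ℂ currentToAffine f ∈ _
      rw [Finsupp.lsum_apply]
      exact sum_mem fun n _ => currentToAffine_mem (hf n)
  map_d x := by
    induction x using ModeLie.induction_modeOf with
    | hadd x y hx hy => simp only [map_add, hx, hy]
    | hof n u =>
      have e : hU.modeLieD (modeOf currentD n u) = modeOf currentD n (currentDiff d u) := by
        simp [IsDGVertexLieAlgebra.modeLieD, modeOf, loopD]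
      rw [e, modeLieEquivAffine_modeOf, modeLieEquivAffine_modeOf]
      clear e
      induction u using Current.induction_currentOf with
      | hK c =>
        simp only [map_smul, currentDiff_currentK, currentToAffine_currentK, affineD_affineK,
          smul_zero, map_zero]
      | hadd u v hu hv => simp only [map_add, hu, hv]
      | hof k a =>
        rw [currentDiff_currentOf, currentToAffine_currentOf, currentToAffine_currentOf, map_smul,
          affineD_affineOf]
  map_br x y := by
    have h := modeLieBracket_affineToModeLie hU (modeLieEquivAffine x) (modeLieEquivAffine y)
    change hU.modeLieBracket (modeLieEquivAffine.symm _) (modeLieEquivAffine.symm _) =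
      modeLieEquivAffine.symm _ at h
    rw [LinearEquiv.symm_apply_apply, LinearEquiv.symm_apply_apply] at h
    rw [h, LinearEquiv.apply_symm_apply]

end Iso

end DGVertex

end

/-! ### The proposition -/

theorem mainTheorem9 {g : Type*} [AddCommGroup g] [Module ℂ g] (N : ℤ)
    (𝒢 : ℤ → Submodule ℂ g) (d : g →ₗ[ℂ] g) (br : g →ₗ[ℂ] g →ₗ[ℂ] g)
    (form : g →ₗ[ℂ] g →ₗ[ℂ] ℂ)
    (hg : IsDGLieAlgebra (-2 * N) 𝒢 d br)
    (hform : IsInvariantForm (-2 * N) 𝒢 d br form) :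
    ∃ hU : IsDGVertexLieAlgebra N (currentDeg N 𝒢) (currentDiff d) (currentMode br form) currentD,
      IsDGLieAlgebra (-2 * N) (modeLieDeg N (currentDeg N 𝒢) currentD)
        hU.modeLieD hU.modeLieBracket ∧
      IsDGLieAlgebra (-2 * N) (affineDeg N 𝒢) (affineD d) (affineBracket br form) ∧
      ∃ φ : ModeLie (currentD : Current g →ₗ[ℂ] Current g) ≃ₗ[ℂ] Affine g,
        IsDGLieIso (modeLieDeg N (currentDeg N 𝒢) currentD) hU.modeLieD hU.modeLieBracket
          (affineDeg N 𝒢) (affineD d) (affineBracket br form) φ ∧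
        (∀ (a : g) (n : ℤ), φ (modeOf currentD n (currentOf 0 a)) = affineOf n a) ∧
        φ (modeOf currentD (-1) currentK) = affineK := by
  have hU := isDGVertexLieAlgebra_current hg hform
  have hA := isDGLieAlgebra_affine hg hform
  have hφ := isDGLieIso_modeLieEquivAffine hU
  refine ⟨hU, hφ.isDGLieAlgebra hA, hA, modeLieEquivAffine, hφ,
    fun a n => modeLieEquivAffine_generator n a, ?_⟩
  rw [modeLieEquivAffine_currentK, if_pos rfl, one_smul]
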